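/- **Setting.** Let $\varphi$ be the standard normal density. For a probability measure $H$ on $\mathbb R$ let $f_H=\varphi\star dH$, i.e. $f_H(x)=\int\varphi(x-\mu)\,dH(\mu)$, and let $E_H$, $\mathrm{Var}_H$ denote expectation and variance when $X$ has density $f_H$ (equivalently $\mu\sim H$, $X\mid\mu\sim N(\mu,1)$). Let $\mathcal G$ be a convex set of probability measures on $\mathbb R$, let $G\in\mathcal G$, and let $L(H)=\int\psi\,dH$, where $\psi$ is integrable with respect to every $H\in\mathcal G$ and $\sup_{H\in\mathcal G}|L(H)|<\infty$. Fix $M>0$ and put $$\|h\|_{\infty,M}=\max\Big\{\sup_{|x|\le M}|h(x)|,\ \Big|\int_{-\infty}^{-M}h\Big|,\ \Big|\int_M^\infty h\Big|\Big\}.$$ Let $\tilde{\mathbf X}=(\tilde X_i)_{i\ge1}$ (first fold) and $(X_i)_{i\ge1}$ (second fold) be independent random variables, all with density $f_G$, on a common probability space with probability $P$. For each $m$ let the pilot density $\bar f_m$ (jointly measurable, integrable on the two tails $(-\infty,-M]$ and $[M,\infty)$), the radius $c_m$, the number $\delta_m>0$ and the number $\omega_m'(\delta_m)$ below be measurable functions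 of $\tilde{\mathbf X}$. Define $$\mathcal G_m=\{H\in\mathcal G:\ \|f_H-\bar f_m\|_{\infty,M}\le c_m\},$$ $$D_m(G_1,G_{-1})=\frac{\big(\int_{-\infty}^{-M}(f_{G_1}-f_{G_{-1}})\big)^2}{\int_{-\infty}^{-M}\bar f_m}+\int_{-M}^{M}\frac{(f_{G_1}-f_{G_{-1}})^2}{\bar f_m}+\frac{\big(\int_{M}^{\infty}(f_{G_1}-f_{G_{-1}})\big)^2}{\int_{M}^{\infty}\bar f_m},$$ $$\omega_m(\delta)=\sup\{L(G_1)-L(G_{-1}):\ G_1,G_{-1}\in\mathcal G_m,\ D_m(G_1,G_{-1})\le\delta^2\}.$$ **Assumptions.** As $m\to\infty$: 1. $P(\|f_G-\bar f_m\|_{\infty,M}\le c_m)\to1$; 2. $c_m\to0$ in probability and $c_m^2/(m\delta_m^2)\to0$ in probability; 3. with probability tending to one, $\omega_m'(\delta_m)$ is an element of the superdifferential of $\omega_m$ at $\delta_m$, and $\omega_m'(\delta_m)>0$; put $\Gamma_m=m^{-1}\omega_m'(\delta_m)^2$; 4. with probability tending to one the supremum $\omega_m(\delta_m)$ is attained,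 i.e. there are $G_1,G_{-1}\in\mathcal G_m$ with $D_m(G_1,G_{-1})\le\delta_m^2$ and $L(G_1)-L(G_{-1})=\omega_m(\delta_m)$. **Estimator.** Let $(Q_0,Q)$, a measurable function of $\tilde{\mathbf X}$ (jointly measurable in $\tilde{\mathbf X}$ and $x$ for $Q$), solve, with probability tending to one whenever a solution exists, $$\min_{Q_0,Q}\ \sup_{H\in\mathcal G_m}\big(Q_0+E_H[Q(X)]-L(H)\big)^2\quad\text{subject to}\quad \frac1m\int Q^2\bar f_m\le\Gamma_m,$$ over real $Q_0$ and measurable $Q:\mathbb R\to\mathbb R$ that are constant on $(-\infty,-M]$ and constant on $[M,\infty)$, with $Q^2\bar f_m$ integrable and with $E_H|Q(X)|<\infty$ for $H\in\mathcal G_m$. Put $$\hat L=Q_0+\frac1m\sum_{i=1}^mQ(X_i),\qquad \hat V=\frac1{m(m-1)}\Big[\sum_{i=1}^mQ^2(X_i)-\frac1m\Big(\sum_{i=1}^mQ(X_i)\Big)^2\Big],$$ $$\hat B^2=\sup_{H\in\mathcal G_m}\big(Q_0+E_H[Q(X)]-L(H)\big)^2,\qquad \mathrm{Bias}=E_G[\hat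 L\mid\tilde{\mathbf X}]-L(G).$$ Here $E_G[\,\cdot\mid\tilde{\mathbf X}]$ and $\mathrm{Var}_G[\,\cdot\mid\tilde{\mathbf X}]$ are computed by holding $\tilde{\mathbf X}$ fixed and integrating over the law of $(X_1,\dots,X_m)$. **Theorem.** As $m\to\infty$, - $\big(\hat L-L(G)-\mathrm{Bias}\big)\big/\sqrt{\mathrm{Var}_G[\hat L\mid\tilde{\mathbf X}]}\to N(0,1)$ in distribution; - $\hat V/\mathrm{Var}_G[\hat L\mid\tilde{\mathbf X}]\to1$ and $\int Q^2\bar f_m\,dx\big/\big(m\,\mathrm{Var}_G[\hat L\mid\tilde{\mathbf X}]\big)\to1$ in probability; - $P(|\mathrm{Bias}|\le\hat B)\to1$. -/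

import Mathlib

open MeasureTheory ProbabilityTheory Filter Topology Set
open scoped ENNReal NNReal

noncomputable section

namespace MinimaxAffine

/-- The marginal density `f_G = φ ⋆ dG` of `X`, where `μ ∼ G` and `X ∣ μ ∼ N(μ, 1)`. -/
def marginalDensity (G : Measure ℝ) (x : ℝ) : ℝ :=
  ∫ u, gaussianPDFReal 0 1 (x - u) ∂G

/-- The law of one observation: the measure on `ℝ` with Lebesgue density `f_G`. -/
def marginalLaw (G : Measure ℝ) : Measure ℝ :=
  volume.withDensity fun x => ENNReal.ofReal (marginalDensity G x)

/-- The linear functional `L(G) = ∫ ψ dG`. -/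
def linFun (ψ : ℝ → ℝ) (G : Measure ℝ) : ℝ := ∫ u, ψ u ∂G

/-- `‖h‖_{∞,M}`: the maximum of `sup_{[-M,M]} |h|` and of the absolute values of the integrals of
`h` over the two tails. Extended-real valued, so that an unbounded `h` has norm `⊤`. -/
def normInfM (M : ℝ) (h : ℝ → ℝ) : EReal :=
  max (⨆ x ∈ Icc (-M) M, ((|h x| : ℝ) : EReal))
    (max ((|∫ x in Iic (-M), h x| : ℝ) : EReal) ((|∫ x in Ici M, h x| : ℝ) : EReal))

/-- The localized class `𝒢_m` of all `H ∈ 𝒢` with `‖f_H - fbar‖_{∞,M} ≤ c`. -/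
def localClass (𝒢 : Set (Measure ℝ)) (M : ℝ) (fbar : ℝ → ℝ) (c : ℝ) : Set (Measure ℝ) :=
  {H ∈ 𝒢 | normInfM M (fun x => marginalDensity H x - fbar x) ≤ (c : EReal)}

/-- The weighted squared distance between `f_{G₁}` and `f_{G₂}` in the modulus problem, where each
of the two tails counts as a single cell. -/
def sqDist (M : ℝ) (fbar : ℝ → ℝ) (G₁ G₂ : Measure ℝ) : ℝ :=
  (∫ x in Iic (-M), (marginalDensity G₁ x - marginalDensity G₂ x)) ^ 2 / (∫ x in Iic (-M), fbar x)
  + (∫ x in Icc (-M) M, (marginalDensity G₁ x - marginalDensity G₂ x) ^ 2 / fbar x)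
  + (∫ x in Ici M, (marginalDensity G₁ x - marginalDensity G₂ x)) ^ 2 / (∫ x in Ici M, fbar x)

/-- The modulus of continuity of `L = ∫ ψ` over the class `𝒢m`. -/
def modulus (ψ : ℝ → ℝ) (M : ℝ) (fbar : ℝ → ℝ) (𝒢m : Set (Measure ℝ)) (δ : ℝ) : ℝ :=
  sSup {r : ℝ | ∃ G₁ ∈ 𝒢m, ∃ G₂ ∈ 𝒢m, sqDist M fbar G₁ G₂ ≤ δ ^ 2 ∧
    r = linFun ψ G₁ - linFun ψ G₂}

/-- The modulus problem at `δ` has a solution. -/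
def ModulusAttained (ψ : ℝ → ℝ) (M : ℝ) (fbar : ℝ → ℝ) (𝒢m : Set (Measure ℝ)) (δ : ℝ) : Prop :=
  ∃ G₁ ∈ 𝒢m, ∃ G₂ ∈ 𝒢m, sqDist M fbar G₁ G₂ ≤ δ ^ 2 ∧
    linFun ψ G₁ - linFun ψ G₂ = modulus ψ M fbar 𝒢m δ

/-- `s` lies in the superdifferential at `δ` of the function `w` on `(0, ∞)`. -/
def IsSupergradient (w : ℝ → ℝ) (δ s : ℝ) : Prop :=
  ∀ t, 0 < t → w t ≤ w δ + s * (t - δ)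

/-- The admissible weighting functions `Q` of the minimax problem: `Q` is constant on each of the
tails `(-∞, -M]` and `[M, ∞)`, has an expectation under every member of `𝒢m`, and satisfies
`m⁻¹ ∫ Q² fbar ≤ Γ`. -/
structure IsAdmissible (M : ℝ) (m : ℕ) (fbar : ℝ → ℝ) (𝒢m : Set (Measure ℝ)) (Γ : ℝ)
    (q : ℝ → ℝ) : Prop where
  measurable : Measurable q
  const_left : ∀ x ≤ -M, q x = q (-M)
  const_right : ∀ x ≥ M, q x = q M
  integrable : ∀ H ∈ 𝒢m, Integrable q (marginalLaw H)
  integrable_sq : Integrable fun x => q x ^ 2 * fbar x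
  variance_le : (∫ x, q x ^ 2 * fbar x) / m ≤ Γ

/-- The worst-case squared bias over `𝒢m` of the affine estimator with offset `q₀` and
weighting function `q`. -/
def worstSqBias (ψ : ℝ → ℝ) (𝒢m : Set (Measure ℝ)) (q₀ : ℝ) (q : ℝ → ℝ) : ℝ≥0∞ :=
  ⨆ H ∈ 𝒢m, ENNReal.ofReal ((q₀ + (∫ x, q x ∂(marginalLaw H)) - linFun ψ H) ^ 2)

/-- `(q₀, q)` solves the minimax problem: it minimizes the worst-case squared bias over `𝒢m`
among all pairs with an admissible weighting function. -/
def IsMinimaxSolution (ψ : ℝ → ℝ) (M : ℝ) (m : ℕ) (fbar : ℝ → ℝ) (𝒢m : Set (Measure ℝ)) (Γ : ℝ)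
    (q₀ : ℝ) (q : ℝ → ℝ) : Prop :=
  IsAdmissible M m fbar 𝒢m Γ q ∧
    ∀ (r₀ : ℝ) (r : ℝ → ℝ), IsAdmissible M m fbar 𝒢m Γ r →
      worstSqBias ψ 𝒢m q₀ q ≤ worstSqBias ψ 𝒢m r₀ r

/-- The worst-case bias `B̂`. -/
def biasBound (ψ : ℝ → ℝ) (𝒢m : Set (Measure ℝ)) (q₀ : ℝ) (q : ℝ → ℝ) : ℝ :=
  √(worstSqBias ψ 𝒢m q₀ q).toReal

/-- The affine estimator `L̂ = Q₀ + m⁻¹ ∑ᵢ Q(Xᵢ)`. -/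
def affineEstimator {m : ℕ} (q₀ : ℝ) (q : ℝ → ℝ) (x : Fin m → ℝ) : ℝ :=
  q₀ + (∑ i, q (x i)) / m

/-- The variance estimate `V̂`. -/
def sampleVar {m : ℕ} (q : ℝ → ℝ) (x : Fin m → ℝ) : ℝ :=
  1 / ((m : ℝ) * ((m : ℝ) - 1)) * ((∑ i, q (x i) ^ 2) - (∑ i, q (x i)) ^ 2 / m)

/-- The joint law of the second fold `(X₁, …, X_m)`. As the second fold is independent of the
first, it is also the conditional law of the second fold given the first. -/
def sampleLaw (G : Measure ℝ) (m : ℕ) : Measure (Fin m → ℝ) :=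
  Measure.pi fun _ => marginalLaw G

/-- The conditional bias `E_G[L̂ ∣ X̃] - L(G)`, where `q₀` and `q` are the (frozen) values of
`Q₀` and `Q` at the first fold. -/
def condBias (ψ : ℝ → ℝ) (G : Measure ℝ) (m : ℕ) (q₀ : ℝ) (q : ℝ → ℝ) : ℝ :=
  (∫ x, affineEstimator q₀ q x ∂(sampleLaw G m)) - linFun ψ G

/-- The conditional variance `Var_G[L̂ ∣ X̃]`, where `q₀` and `q` are the (frozen) values of
`Q₀` and `Q` at the first fold. -/
def condVariance (G : Measure ℝ) (m : ℕ) (q₀ : ℝ) (q : ℝ → ℝ) : ℝ :=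
  variance (affineEstimator q₀ q) (sampleLaw G m)

/-- The events `E m` have probability tending to one. For measurable events this is
`P (E m) → 1`; for arbitrary sets it says that the inner probability tends to one. -/
def WithHighProb {Ω : Type*} [MeasurableSpace Ω] (P : Measure Ω) (E : ℕ → Set Ω) : Prop :=
  Tendsto (fun m => P (E m)ᶜ) atTop (𝓝 0)

end MinimaxAffine

end

open MinimaxAffine

/-!
Fix the first fold, on the event that `f_G` lies in the band and the other assumptions hold. If each
tail is collapsed to an atom, the pilot becomes a finite measure (`cellMeasure`), the weightings
become elements of its `L²`, the variance constraint becomes a bound on the norm, and the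
difference of the densities of two members of the class is represented by a vector
(`ratioDiff`) whose squared norm is `sqDist`. In this Hilbert space the minimax problem is solved
by duality: if `(H₁, H₂)` attains the modulus `ω` at `δ` and `s` is a positive supergradient there,
then `s` is the Lagrange multiplier of the modulus problem, the weighting
`(s / δ) • ratioDiff H₁ H₂` has worst-case bias `(ω(δ) - s δ) / 2`, and the Cauchy-Schwarz
inequality for the pair `(H₁, H₂)` shows that no admissible weighting does better and that any
other solution agrees with this one almost everywhere (`minimaxSolution_eq`).

Hence the weighting `Q` is known. Both `H₁` and `H₂` lie in the band, so `|Q|` is at most a constant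
times `c s / δ`, while `∫ Q² fbar = s²`; as the representer integrates to `f_{H₁} - f_{H₂}`, the
integral of `Q` against `fbar` vanishes. Since `f_G` is bounded below on the cells, the band makes
`f_G / fbar` uniformly close to one, so the variance of `Q` under `f_G` is `s² (1 + O(c))`
(`minimaxSolution_estimates`). The standardized weighting divided by `√m` is therefore of order
`c / (δ √m)`, which tends to zero in probability.

It remains to prove limit theorems for a bounded triangular array, given the first fold: a Taylor
expansion bounds the distance of the conditional characteristic function to the Gaussian one
(`norm_integral_cexp_estimator_sub_le`), and Chebyshev's inequality controls the sample variance
(`sampleLaw_abs_sampleVar_div_sub_one_ge_le`). The joint law of the two folds is a product, so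
unconditional characteristic functions and probabilities are means of conditional ones, and bounded
convergence in probability together with Lévy's continuity theorem finishes the proof.
-/

namespace MinimaxAffine

/-! ### Gaussian location mixtures -/

lemma gaussianPDFReal_zero_one_le (x : ℝ) : gaussianPDFReal 0 1 x ≤ 1 := by
  have h1 : (1 : ℝ) ≤ √(2 * Real.pi * ((1 : ℝ≥0) : ℝ)) := by
    rw [Real.one_le_sqrt]
    have := Real.pi_gt_three
    norm_num
    linarith
  rw [gaussianPDFReal_def]
  refine mul_le_one₀ (inv_le_one_of_one_le₀ h1) (Real.exp_nonneg _) (Real.exp_le_one_iff.2 ?_)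
  refine div_nonpos_of_nonpos_of_nonneg (neg_nonpos.2 (sq_nonneg _)) (by norm_num)

lemma continuous_gaussianPDFReal_zero_one : Continuous (gaussianPDFReal 0 1) := by
  rw [gaussianPDFReal_def]
  fun_prop

lemma integrable_gaussianPDFReal_sub (H : Measure ℝ) [IsFiniteMeasure H] (x : ℝ) :
    Integrable (fun u => gaussianPDFReal 0 1 (x - u)) H := by
  refine Integrable.of_bound (C := 1) ?_ (ae_of_all _ fun u => ?_)
  · exact (continuous_gaussianPDFReal_zero_one.comp
      (continuous_const.sub continuous_id)).aestronglyMeasurable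
  · rw [Real.norm_of_nonneg (gaussianPDFReal_nonneg _ _ _)]
    exact gaussianPDFReal_zero_one_le _

lemma marginalDensity_nonneg (H : Measure ℝ) (x : ℝ) : 0 ≤ marginalDensity H x :=
  integral_nonneg fun _ => gaussianPDFReal_nonneg _ _ _

lemma marginalDensity_pos (H : Measure ℝ) [IsProbabilityMeasure H] (x : ℝ) :
    0 < marginalDensity H x := by
  unfold marginalDensity
  rw [integral_pos_iff_support_of_nonneg (fun _ => gaussianPDFReal_nonneg _ _ _)
    (integrable_gaussianPDFReal_sub H x)]
  have : (Function.support fun u => gaussianPDFReal 0 1 (x - u)) = univ := by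
    ext u
    simpa using (gaussianPDFReal_pos 0 1 (x - u) one_ne_zero).ne'
  rw [this]
  simp

lemma continuous_marginalDensity (H : Measure ℝ) [IsFiniteMeasure H] :
    Continuous (marginalDensity H) := by
  refine continuous_of_dominated (bound := fun _ => 1) (fun x => ?_) (fun x => ?_)
    (integrable_const _) ?_
  · exact (integrable_gaussianPDFReal_sub H x).aestronglyMeasurable
  · refine ae_of_all _ fun u => ?_
    rw [Real.norm_of_nonneg (gaussianPDFReal_nonneg _ _ _)]
    exact gaussianPDFReal_zero_one_le _
  · exact ae_of_all _ fun u => continuous_gaussianPDFReal_zero_one.comp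
      (continuous_id.sub continuous_const)

lemma measurable_marginalDensity (H : Measure ℝ) [IsFiniteMeasure H] :
    Measurable (marginalDensity H) :=
  (continuous_marginalDensity H).measurable

lemma lintegral_marginalDensity (H : Measure ℝ) [IsProbabilityMeasure H] :
    ∫⁻ x, ENNReal.ofReal (marginalDensity H x) = 1 := by
  have h1 : ∀ x, ENNReal.ofReal (marginalDensity H x) = ∫⁻ u, gaussianPDF 0 1 (x - u) ∂H := by
    intro x
    exact ofReal_integral_eq_lintegral_ofReal (integrable_gaussianPDFReal_sub H x)
      (ae_of_all _ fun _ => gaussianPDFReal_nonneg _ _ _)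
  simp_rw [h1]
  rw [lintegral_lintegral_swap]
  · have h2 : ∀ u, ∫⁻ x, gaussianPDF 0 1 (x - u) = 1 := fun u => by
      rw [lintegral_sub_right_eq_self (gaussianPDF 0 1) u,
        lintegral_gaussianPDF_eq_one _ one_ne_zero]
    simp [h2]
  · exact ((measurable_gaussianPDF 0 1).comp (measurable_fst.sub measurable_snd)).aemeasurable

lemma isProbabilityMeasure_marginalLaw (H : Measure ℝ) [IsProbabilityMeasure H] :
    IsProbabilityMeasure (marginalLaw H) :=
  ⟨by simp [marginalLaw, lintegral_marginalDensity]⟩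

lemma integrable_marginalDensity (H : Measure ℝ) [IsProbabilityMeasure H] :
    Integrable (marginalDensity H) := by
  refine ⟨(measurable_marginalDensity H).aestronglyMeasurable, ?_⟩
  rw [hasFiniteIntegral_iff_ofReal (ae_of_all _ (marginalDensity_nonneg H)),
    lintegral_marginalDensity]
  exact ENNReal.one_lt_top

lemma integral_marginalDensity (H : Measure ℝ) [IsProbabilityMeasure H] :
    ∫ x, marginalDensity H x = 1 := by
  rw [integral_eq_lintegral_of_nonneg_ae (ae_of_all _ (marginalDensity_nonneg H))
    (measurable_marginalDensity H).aestronglyMeasurable, lintegral_marginalDensity]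
  rfl

lemma integral_marginalLaw (H : Measure ℝ) [IsProbabilityMeasure H] (q : ℝ → ℝ) :
    ∫ x, q x ∂(marginalLaw H) = ∫ x, q x * marginalDensity H x := by
  unfold marginalLaw
  rw [integral_withDensity_eq_integral_toReal_smul
    (measurable_marginalDensity H).ennreal_ofReal (ae_of_all _ fun _ => ENNReal.ofReal_lt_top)]
  refine integral_congr_ae (ae_of_all _ fun x => ?_)
  simp [ENNReal.toReal_ofReal (marginalDensity_nonneg H x), mul_comm]

lemma integrable_marginalLaw_iff (H : Measure ℝ) [IsProbabilityMeasure H] (q : ℝ → ℝ) :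
    Integrable q (marginalLaw H) ↔ Integrable fun x => q x * marginalDensity H x := by
  unfold marginalLaw
  rw [integrable_withDensity_iff (measurable_marginalDensity H).ennreal_ofReal
    (ae_of_all _ fun _ => ENNReal.ofReal_lt_top)]
  simp [ENNReal.toReal_ofReal (marginalDensity_nonneg H _)]

lemma marginalDensity_add_smul (H₁ H₂ : Measure ℝ) [IsFiniteMeasure H₁] [IsFiniteMeasure H₂]
    (a b : ℝ≥0) (x : ℝ) :
    marginalDensity (a • H₁ + b • H₂) x = a * marginalDensity H₁ x + b * marginalDensity H₂ x := by
  unfold marginalDensity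
  rw [integral_add_measure ((integrable_gaussianPDFReal_sub H₁ x).smul_measure_nnreal)
    ((integrable_gaussianPDFReal_sub H₂ x).smul_measure_nnreal),
    integral_smul_nnreal_measure, integral_smul_nnreal_measure]
  rfl

lemma linFun_add_smul {ψ : ℝ → ℝ} {H₁ H₂ : Measure ℝ} (h₁ : Integrable ψ H₁)
    (h₂ : Integrable ψ H₂) (a b : ℝ≥0) :
    linFun ψ (a • H₁ + b • H₂) = a * linFun ψ H₁ + b * linFun ψ H₂ := by
  unfold linFun
  rw [integral_add_measure h₁.smul_measure_nnreal h₂.smul_measure_nnreal,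
    integral_smul_nnreal_measure, integral_smul_nnreal_measure]
  rfl

/-! ### The supergradient of a modulus in Hilbert space -/

/-- A maximizer of the modulus problem at `δ` uses up the whole budget: if its norm were smaller
than `δ`, the modulus would have the same value at a smaller radius, which a positive
supergradient rules out. -/
lemma norm_eq_of_supergradient {E : Type*} [NormedAddCommGroup E] {w : ℝ → ℝ} {δ s : ℝ} {v₀ : E}
    (hδ : 0 < δ) (hs : 0 < s) (hw : IsSupergradient w δ s) (hv₀ : ‖v₀‖ ≤ δ)
    (h : ∀ t, 0 < t → ‖v₀‖ ≤ t → w δ ≤ w t) :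
    ‖v₀‖ = δ := by
  refine le_antisymm hv₀ (le_of_not_gt fun hlt => ?_)
  -- The midpoint of `‖v₀‖` and `δ` is positive even if `v₀ = 0`.
  have h1 := h ((‖v₀‖ + δ) / 2) (by positivity) (by linarith)
  have h2 := hw ((‖v₀‖ + δ) / 2) (by positivity)
  nlinarith

section Hilbert

variable {E : Type*} [NormedAddCommGroup E] [InnerProductSpace ℝ E]

/-- The Lagrange inequality of the modulus problem: the multiplier of the constraint `‖v‖ ≤ δ` is
the supergradient `s`. Moving from the maximizer `v₀` towards `v` along the segment gives a lower
bound of the modulus at the norms on the segment, and the derivative at the starting point is the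
assertion. -/
lemma sub_inner_le_of_supergradient {w : ℝ → ℝ} {δ s l : ℝ} {v₀ v : E} (hδ : 0 < δ)
    (hw : IsSupergradient w δ s) (hv₀ : ‖v₀‖ = δ)
    (h : ∀ r ∈ Ioo (0 : ℝ) 1, ∀ t, 0 < t → ‖v₀ + r • (v - v₀)‖ ≤ t →
      w δ + r * (l - w δ) ≤ w t) :
    l - (s / δ) * inner ℝ v₀ v ≤ w δ - s * δ := by
  set d := v - v₀ with hd
  set a : ℝ := inner ℝ v₀ d / δ with ha
  set b : ℝ := ‖d‖ ^ 2 / (2 * δ) with hb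
  have hinner : inner ℝ v₀ v = δ * a + δ ^ 2 := by
    have : v = v₀ + d := by simp [hd]
    rw [this, inner_add_right, real_inner_self_eq_norm_sq, hv₀, ha]
    field_simp
    ring
  have key : ∀ r ∈ Ioo (0 : ℝ) 1, l - w δ - s * a ≤ r * (s * b) := by
    intro r hr
    -- The radius `t` is the tangent bound `√(δ² + y) ≤ δ + y / (2 δ)` for the norm on the segment.
    set t : ℝ := δ + r * a + r ^ 2 * b with ht
    have hN : ‖v₀ + r • d‖ ^ 2 = δ ^ 2 + 2 * δ * (r * a + r ^ 2 * b) := by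
      rw [norm_add_sq_real, hv₀, inner_smul_right, norm_smul, mul_pow, Real.norm_eq_abs, sq_abs,
        ha, hb]
      field_simp
      ring
    have ht0 : 0 < t := by
      have : 0 < 2 * δ * t := by nlinarith [sq_nonneg ‖v₀ + r • d‖]
      exact pos_of_mul_pos_right this (by positivity)
    have hNt : ‖v₀ + r • d‖ ≤ t := by
      refine (sq_le_sq₀ (norm_nonneg _) ht0.le).1 ?_
      rw [hN, ht]
      nlinarith [sq_nonneg (r * a + r ^ 2 * b)]
    have h1 := h r hr t ht0 hNt
    have h2 := hw t ht0
    have h3 : r * (l - w δ - s * a) ≤ r * (r * (s * b)) := by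
      have : s * (t - δ) = s * (r * a + r ^ 2 * b) := by rw [ht]; ring
      nlinarith
    exact le_of_mul_le_mul_left h3 hr.1
  have hle : l - w δ - s * a ≤ 0 := by
    have hlim : Tendsto (fun r : ℝ => r * (s * b)) (𝓝[>] 0) (𝓝 0) := by
      have : Tendsto (fun r : ℝ => r * (s * b)) (𝓝 0) (𝓝 (0 * (s * b))) :=
        (continuous_id.mul continuous_const).tendsto 0
      rw [zero_mul] at this
      exact this.mono_left nhdsWithin_le_nhds
    refine ge_of_tendsto hlim ?_
    filter_upwards [Ioo_mem_nhdsGT (zero_lt_one' ℝ)] with r hr using key r hr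
  have : s / δ * inner ℝ v₀ v = s * a + s * δ := by
    rw [hinner]
    field_simp
  linarith

/-- The case of equality in the Cauchy-Schwarz inequality. -/
lemma eq_smul_of_inner_ge {s δ : ℝ} {q v : E} (hδ : 0 < δ) (hs : 0 ≤ s) (hq : ‖q‖ ≤ s)
    (hv : ‖v‖ = δ) (h : s * δ ≤ inner ℝ q v) : q = (s / δ) • v := by
  have h0 : ‖q - (s / δ) • v‖ ^ 2 ≤ 0 := by
    rw [norm_sub_sq_real, inner_smul_right, norm_smul, hv, Real.norm_of_nonneg (by positivity),
      div_mul_cancel₀ _ hδ.ne']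
    have h1 : s * s ≤ s / δ * inner ℝ q v := by
      rw [div_mul_eq_mul_div, le_div_iff₀ hδ]
      nlinarith
    nlinarith [norm_nonneg q]
  have h1 := pow_eq_zero_iff two_ne_zero |>.1 (le_antisymm h0 (sq_nonneg _))
  exact sub_eq_zero.1 (norm_eq_zero.1 h1)

end Hilbert

/-! ### Localized classes -/

lemma normInfM_le_iff {M c : ℝ} {h : ℝ → ℝ} :
    normInfM M h ≤ (c : EReal) ↔ (∀ x ∈ Icc (-M) M, |h x| ≤ c) ∧
      |∫ x in Iic (-M), h x| ≤ c ∧ |∫ x in Ici M, h x| ≤ c := by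
  simp only [normInfM, max_le_iff, iSup_le_iff, EReal.coe_le_coe_iff]

lemma convex_localClass {𝒢 : Set (Measure ℝ)} (hprob : ∀ H ∈ 𝒢, IsProbabilityMeasure H)
    (hconv : Convex ℝ≥0 𝒢) {M c : ℝ} {fbar : ℝ → ℝ} (hl : IntegrableOn fbar (Iic (-M)))
    (hr : IntegrableOn fbar (Ici M)) : Convex ℝ≥0 (localClass 𝒢 M fbar c) := by
  rintro H₁ ⟨h₁, hn₁⟩ H₂ ⟨h₂, hn₂⟩ a b - - hab
  refine ⟨hconv h₁ h₂ zero_le zero_le hab, ?_⟩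
  have := hprob H₁ h₁
  have := hprob H₂ h₂
  have hab' : (a : ℝ) + b = 1 := by exact_mod_cast hab
  have hcomb : ∀ u v : ℝ, |u| ≤ c → |v| ≤ c → |a * u + b * v| ≤ c := fun u v hu hv => by
    have ha := a.coe_nonneg
    have hb := b.coe_nonneg
    rw [abs_le] at *
    constructor <;> nlinarith
  have hint : ∀ S : Set ℝ, IntegrableOn fbar S →
      ∫ x in S, (marginalDensity (a • H₁ + b • H₂) x - fbar x) =
      a * (∫ x in S, (marginalDensity H₁ x - fbar x))
        + b * (∫ x in S, (marginalDensity H₂ x - fbar x)) := fun S hS => by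
    rw [← integral_const_mul, ← integral_const_mul, ← integral_add]
    · refine integral_congr_ae (ae_of_all _ fun x => ?_)
      simp only [marginalDensity_add_smul]
      linear_combination (fbar x) * hab'
    · exact ((integrable_marginalDensity H₁).integrableOn.sub hS).const_mul _
    · exact ((integrable_marginalDensity H₂).integrableOn.sub hS).const_mul _
  rw [normInfM_le_iff] at *
  refine ⟨fun x hx => ?_, ?_, ?_⟩
  · have : marginalDensity (a • H₁ + b • H₂) x - fbar x =
        a * (marginalDensity H₁ x - fbar x) + b * (marginalDensity H₂ x - fbar x) := by
      rw [marginalDensity_add_smul]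
      linear_combination (fbar x) * hab'
    rw [this]
    exact hcomb _ _ (hn₁.1 x hx) (hn₂.1 x hx)
  · rw [hint _ hl]
    exact hcomb _ _ hn₁.2.1 hn₂.2.1
  · rw [hint _ hr]
    exact hcomb _ _ hn₁.2.2 hn₂.2.2

/-! ### The cell measure -/

/-- The measure attached to the pilot density when each tail is a single cell: the tails are
represented by atoms at `-M` and `M` carrying the integral of `fbar` over the tail, and between
them the measure has density `fbar`. For a function `q` that is constant on the tails, integration
of `q` against this measure is integration of `q * fbar` over the line. -/
noncomputable def cellMeasure (M : ℝ) (fbar : ℝ → ℝ) : Measure ℝ :=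
  ENNReal.ofReal (∫ x in Iic (-M), fbar x) • Measure.dirac (-M)
    + (volume.restrict (Ioo (-M) M)).withDensity (fun x => ENNReal.ofReal (fbar x))
    + ENNReal.ofReal (∫ x in Ici M, fbar x) • Measure.dirac M

open Classical in
/-- The density of `h` relative to `fbar` on the cells: the quotient `h / fbar` on `(-M, M)` and the
quotient of the tail integrals on each tail. -/
noncomputable def cellRatio (M : ℝ) (fbar h : ℝ → ℝ) (x : ℝ) : ℝ :=
  if x ≤ -M then (∫ y in Iic (-M), h y) / (∫ y in Iic (-M), fbar y)
  else if M ≤ x then (∫ y in Ici M, h y) / (∫ y in Ici M, fbar y)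
  else h x / fbar x

/-- A pilot function that is bounded, and bounded below by `κ > 0`, on `[-M, M]`, and whose tail
integrals exist and are at least `κ`. It need not be nonnegative on the tails. -/
structure IsRegularPilot (M κ : ℝ) (fbar : ℝ → ℝ) : Prop where
  measurable : Measurable fbar
  integrableOn_left : IntegrableOn fbar (Iic (-M))
  integrableOn_right : IntegrableOn fbar (Ici M)
  pos : 0 < κ
  le : ∀ x ∈ Icc (-M) M, κ ≤ fbar x
  bdd : ∃ C, ∀ x ∈ Icc (-M) M, fbar x ≤ C
  le_left : κ ≤ ∫ x in Iic (-M), fbar x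
  le_right : κ ≤ ∫ x in Ici M, fbar x

section Cells

variable {M κ : ℝ} {fbar : ℝ → ℝ}

lemma integrable_of_pieces {g : ℝ → ℝ} (h₁ : IntegrableOn g (Iic (-M)))
    (h₂ : IntegrableOn g (Ioo (-M) M)) (h₃ : IntegrableOn g (Ici M)) : Integrable g := by
  have : (univ : Set ℝ) = Iic (-M) ∪ Ioo (-M) M ∪ Ici M := by
    ext x
    simp only [mem_univ, mem_union, mem_Iic, mem_Ioo, mem_Ici, true_iff]
    grind
  rw [← integrableOn_univ, this]
  exact (h₁.union h₂).union h₃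

lemma integral_eq_pieces (hM : 0 < M) {g : ℝ → ℝ} (h₁ : IntegrableOn g (Iic (-M)))
    (h₂ : IntegrableOn g (Ioo (-M) M)) (h₃ : IntegrableOn g (Ici M)) :
    ∫ x, g x = (∫ x in Iic (-M), g x) + (∫ x in Ioo (-M) M, g x) + ∫ x in Ici M, g x := by
  have : (univ : Set ℝ) = (Iic (-M) ∪ Ioo (-M) M) ∪ Ici M := by
    ext x
    simp only [mem_univ, mem_union, mem_Iic, mem_Ioo, mem_Ici, true_iff]
    grind
  rw [← setIntegral_univ, this, setIntegral_union _ measurableSet_Ici (h₁.union h₂) h₃,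
    setIntegral_union _ measurableSet_Ioo h₁ h₂]
  · exact Set.disjoint_left.2 fun x hx hx' => by simp at hx hx'; linarith
  · refine Set.disjoint_left.2 fun x hx hx' => ?_
    simp at hx hx'
    rcases hx with hx | hx <;> linarith

/-- A function that is constant on each tail is integrated over the line by taking the tails as
cells. -/
lemma integrable_and_integral_mul_eq_pieces (hM : 0 < M) {q g : ℝ → ℝ}
    (hl : ∀ x ≤ -M, q x = q (-M))
    (hr : ∀ x ≥ M, q x = q M) (h₁ : IntegrableOn g (Iic (-M)))
    (h₂ : IntegrableOn (fun x => q x * g x) (Ioo (-M) M)) (h₃ : IntegrableOn g (Ici M)) :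
    Integrable (fun x => q x * g x) ∧
    ∫ x, q x * g x = q (-M) * (∫ x in Iic (-M), g x) + (∫ x in Ioo (-M) M, q x * g x)
      + q M * ∫ x in Ici M, g x := by
  have e₁ : EqOn (fun x => q (-M) * g x) (fun x => q x * g x) (Iic (-M)) := fun x hx => by
    simp only [hl x hx]
  have e₃ : EqOn (fun x => q M * g x) (fun x => q x * g x) (Ici M) := fun x hx => by
    simp only [hr x hx]
  have i₁ : IntegrableOn (fun x => q x * g x) (Iic (-M)) :=
    IntegrableOn.congr_fun (h₁.const_mul _) e₁ measurableSet_Iic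
  have i₃ : IntegrableOn (fun x => q x * g x) (Ici M) :=
    IntegrableOn.congr_fun (h₃.const_mul _) e₃ measurableSet_Ici
  refine ⟨integrable_of_pieces i₁ h₂ i₃, ?_⟩
  rw [integral_eq_pieces hM i₁ h₂ i₃, ← setIntegral_congr_fun measurableSet_Iic e₁,
    ← setIntegral_congr_fun measurableSet_Ici e₃, integral_const_mul, integral_const_mul]

lemma IsRegularPilot.left_pos (hf : IsRegularPilot M κ fbar) : 0 < ∫ x in Iic (-M), fbar x :=
  hf.pos.trans_le hf.le_left

lemma IsRegularPilot.right_pos (hf : IsRegularPilot M κ fbar) : 0 < ∫ x in Ici M, fbar x :=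
  hf.pos.trans_le hf.le_right

lemma IsRegularPilot.pos_of_mem (hf : IsRegularPilot M κ fbar) {x : ℝ} (hx : x ∈ Ioo (-M) M) :
    0 < fbar x :=
  hf.pos.trans_le (hf.le x (Ioo_subset_Icc_self hx))

lemma IsRegularPilot.integrableOn_Ioo (hf : IsRegularPilot M κ fbar) :
    IntegrableOn fbar (Ioo (-M) M) := by
  obtain ⟨C, hC⟩ := hf.bdd
  refine Measure.integrableOn_of_bounded (M := C) (by simp) hf.measurable.aestronglyMeasurable ?_
  refine (ae_restrict_iff' measurableSet_Ioo).2 (ae_of_all _ fun x hx => ?_)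
  rw [Real.norm_of_nonneg (hf.pos_of_mem hx).le]
  exact hC x (Ioo_subset_Icc_self hx)

lemma IsRegularPilot.isFiniteMeasure (hf : IsRegularPilot M κ fbar) :
    IsFiniteMeasure (cellMeasure M fbar) := by
  have h : IsFiniteMeasure
      ((volume.restrict (Ioo (-M) M)).withDensity fun x => ENNReal.ofReal (fbar x)) :=
    isFiniteMeasure_withDensity_ofReal hf.integrableOn_Ioo.2
  have h₁ : IsFiniteMeasure (ENNReal.ofReal (∫ x in Iic (-M), fbar x) • Measure.dirac (-M)) :=
    Measure.smul_finite _ ENNReal.ofReal_ne_top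
  have h₂ : IsFiniteMeasure (ENNReal.ofReal (∫ x in Ici M, fbar x) • Measure.dirac M) :=
    Measure.smul_finite _ ENNReal.ofReal_ne_top
  unfold cellMeasure
  infer_instance

lemma IsRegularPilot.integrable_cellMeasure_iff (hf : IsRegularPilot M κ fbar) {r : ℝ → ℝ} :
    Integrable r (cellMeasure M fbar) ↔ IntegrableOn (fun x => r x * fbar x) (Ioo (-M) M) := by
  have hd : ∀ (a : ℝ) (y : ℝ), Integrable r (ENNReal.ofReal a • Measure.dirac y) := fun a y =>
    (integrable_dirac (by simp)).smul_measure ENNReal.ofReal_ne_top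
  unfold cellMeasure
  rw [integrable_add_measure, integrable_add_measure]
  simp only [hd, true_and, and_true]
  rw [integrable_withDensity_iff hf.measurable.ennreal_ofReal
    (ae_of_all _ fun _ => ENNReal.ofReal_lt_top)]
  refine integrable_congr ((ae_restrict_iff' measurableSet_Ioo).2 (ae_of_all _ fun x hx => ?_))
  simp only [ENNReal.toReal_ofReal (hf.pos_of_mem hx).le]

lemma IsRegularPilot.integral_cellMeasure (hf : IsRegularPilot M κ fbar) {r : ℝ → ℝ}
    (hr : Integrable r (cellMeasure M fbar)) :
    ∫ x, r x ∂(cellMeasure M fbar) = (∫ x in Iic (-M), fbar x) * r (-M)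
      + (∫ x in Ioo (-M) M, r x * fbar x) + (∫ x in Ici M, fbar x) * r M := by
  unfold cellMeasure at *
  rw [integrable_add_measure, integrable_add_measure] at hr
  rw [integral_add_measure (hr.1.1.add_measure hr.1.2) hr.2, integral_add_measure hr.1.1 hr.1.2,
    integral_smul_measure, integral_smul_measure, integral_dirac, integral_dirac,
    ENNReal.toReal_ofReal hf.left_pos.le, ENNReal.toReal_ofReal hf.right_pos.le,
    integral_withDensity_eq_integral_toReal_smul hf.measurable.ennreal_ofReal
      (ae_of_all _ fun _ => ENNReal.ofReal_lt_top)]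
  congr 2
  refine setIntegral_congr_fun measurableSet_Ioo fun x hx => ?_
  simp [ENNReal.toReal_ofReal (hf.pos_of_mem hx).le, mul_comm]

lemma cellRatio_of_le {h : ℝ → ℝ} {x : ℝ} (hx : x ≤ -M) : cellRatio M fbar h x =
    (∫ y in Iic (-M), h y) / (∫ y in Iic (-M), fbar y) := by
  simp [cellRatio, hx]

lemma cellRatio_of_ge (hM : 0 < M) {h : ℝ → ℝ} {x : ℝ} (hx : M ≤ x) : cellRatio M fbar h x =
    (∫ y in Ici M, h y) / (∫ y in Ici M, fbar y) := by
  rw [cellRatio, if_neg (by linarith), if_pos hx]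

lemma cellRatio_of_mem {h : ℝ → ℝ} {x : ℝ} (hx : x ∈ Ioo (-M) M) :
    cellRatio M fbar h x = h x / fbar x := by
  rw [cellRatio, if_neg (not_le.2 hx.1), if_neg (not_le.2 hx.2)]

lemma measurable_cellRatio (hf : Measurable fbar) {h : ℝ → ℝ} (hh : Measurable h) :
    Measurable (cellRatio M fbar h) := by
  unfold cellRatio
  exact Measurable.ite measurableSet_Iic measurable_const
    (Measurable.ite measurableSet_Ici measurable_const (hh.div hf))

lemma IsRegularPilot.abs_cellRatio_le (hf : IsRegularPilot M κ fbar) {h : ℝ → ℝ} {b : ℝ}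
    (hb : (∀ x ∈ Icc (-M) M, |h x| ≤ b) ∧
      |∫ x in Iic (-M), h x| ≤ b ∧ |∫ x in Ici M, h x| ≤ b) (x : ℝ) :
    |cellRatio M fbar h x| ≤ b / κ := by
  have hb0 : 0 ≤ b := (abs_nonneg _).trans hb.2.1
  have aux : ∀ u v : ℝ, |u| ≤ b → κ ≤ v → |u / v| ≤ b / κ := fun u v hu hv => by
    have := hf.pos
    rw [abs_div, abs_of_pos (hf.pos.trans_le hv)]
    gcongr
  unfold cellRatio
  split_ifs with h₁ h₂
  · exact aux _ _ hb.2.1 hf.le_left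
  · exact aux _ _ hb.2.2 hf.le_right
  · have : x ∈ Icc (-M) M := ⟨(not_le.1 h₁).le, (not_le.1 h₂).le⟩
    exact aux _ _ (hb.1 x this) (hf.le x this)

/-- Integrals of a tail-constant `q` against `h` are integrals of `q * cellRatio` against the cell
measure. -/
lemma IsRegularPilot.integral_mul_cellRatio (hM : 0 < M) (hf : IsRegularPilot M κ fbar)
    {q h : ℝ → ℝ} (hl : ∀ x ≤ -M, q x = q (-M)) (hr : ∀ x ≥ M, q x = q M)
    (h₁ : IntegrableOn h (Iic (-M))) (h₃ : IntegrableOn h (Ici M))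
    (hq : Integrable (fun x => q x * cellRatio M fbar h x) (cellMeasure M fbar)) :
    Integrable (fun x => q x * h x) ∧
      ∫ x, q x * h x = ∫ x, q x * cellRatio M fbar h x ∂(cellMeasure M fbar) := by
  have e : EqOn (fun x => q x * cellRatio M fbar h x * fbar x) (fun x => q x * h x)
      (Ioo (-M) M) := fun x hx => by
    have := (hf.pos_of_mem hx).ne'
    simp only [cellRatio_of_mem hx]
    field_simp
  have h₂ : IntegrableOn (fun x => q x * h x) (Ioo (-M) M) :=
    (hf.integrable_cellMeasure_iff.1 hq).congr_fun e measurableSet_Ioo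
  obtain ⟨i, hi⟩ := integrable_and_integral_mul_eq_pieces hM hl hr h₁ h₂ h₃
  refine ⟨i, ?_⟩
  have := hf.left_pos.ne'
  have := hf.right_pos.ne'
  rw [hi, hf.integral_cellMeasure hq, setIntegral_congr_fun measurableSet_Ioo e,
    cellRatio_of_le le_rfl, cellRatio_of_ge hM le_rfl]
  field_simp

lemma IsRegularPilot.integral_mul_pilot (hM : 0 < M) (hf : IsRegularPilot M κ fbar) {q : ℝ → ℝ}
    (hl : ∀ x ≤ -M, q x = q (-M)) (hr : ∀ x ≥ M, q x = q M)
    (hq : Integrable q (cellMeasure M fbar)) :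
    Integrable (fun x => q x * fbar x) ∧
      ∫ x, q x * fbar x = ∫ x, q x ∂(cellMeasure M fbar) := by
  obtain ⟨i, hi⟩ := integrable_and_integral_mul_eq_pieces hM hl hr hf.integrableOn_left
    (hf.integrable_cellMeasure_iff.1 hq) hf.integrableOn_right
  refine ⟨i, ?_⟩
  rw [hi, hf.integral_cellMeasure hq]
  ring

lemma IsRegularPilot.integrable_of_bounded (hf : IsRegularPilot M κ fbar) {r : ℝ → ℝ}
    (hr : Measurable r) {b : ℝ} (hb : ∀ x, |r x| ≤ b) : Integrable r (cellMeasure M fbar) := by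
  have := hf.isFiniteMeasure
  exact Integrable.of_bound hr.aestronglyMeasurable b (ae_of_all _ hb)

lemma IsRegularPilot.memLp_of_bounded (hf : IsRegularPilot M κ fbar) {r : ℝ → ℝ}
    (hr : Measurable r) {b : ℝ} (hb : ∀ x, |r x| ≤ b) : MemLp r 2 (cellMeasure M fbar) := by
  have := hf.isFiniteMeasure
  exact MemLp.of_bound hr.aestronglyMeasurable b (ae_of_all _ hb)

lemma IsRegularPilot.integral_sq_cellRatio (hM : 0 < M) (hf : IsRegularPilot M κ fbar) {h : ℝ → ℝ}
    (hh : Measurable h) {b : ℝ} (hb : ∀ x, |cellRatio M fbar h x| ≤ b) :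
    ∫ x, cellRatio M fbar h x ^ 2 ∂(cellMeasure M fbar) =
      (∫ x in Iic (-M), h x) ^ 2 / (∫ x in Iic (-M), fbar x)
      + (∫ x in Icc (-M) M, h x ^ 2 / fbar x)
      + (∫ x in Ici M, h x) ^ 2 / (∫ x in Ici M, fbar x) := by
  have hi : Integrable (fun x => cellRatio M fbar h x ^ 2) (cellMeasure M fbar) :=
    (hf.memLp_of_bounded (measurable_cellRatio hf.measurable hh) hb).integrable_sq
  have := hf.left_pos.ne'
  have := hf.right_pos.ne'
  have e : EqOn (fun x => cellRatio M fbar h x ^ 2 * fbar x) (fun x => h x ^ 2 / fbar x)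
      (Ioo (-M) M) := fun x hx => by
    have := (hf.pos_of_mem hx).ne'
    simp only [cellRatio_of_mem hx]
    field_simp
  rw [hf.integral_cellMeasure hi, setIntegral_congr_fun measurableSet_Ioo e,
    integral_Icc_eq_integral_Ioo, cellRatio_of_le le_rfl, cellRatio_of_ge hM le_rfl]
  field_simp

/-- Agreement almost everywhere for the cell measure forces agreement at the two atoms. -/
lemma IsRegularPilot.ae_volume_of_ae_cellMeasure (hf : IsRegularPilot M κ fbar) {p : ℝ → Prop}
    (hp : ∀ᵐ x ∂(cellMeasure M fbar), p x) :
    p (-M) ∧ (∀ᵐ x ∂(volume.restrict (Ioo (-M) M)), p x) ∧ p M := by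
  unfold cellMeasure at hp
  rw [ae_add_measure_iff, ae_add_measure_iff] at hp
  obtain ⟨⟨h₁, h₂⟩, h₃⟩ := hp
  rw [Measure.ae_ennreal_smul_measure_iff (by simpa using hf.left_pos), ae_dirac_eq] at h₁
  rw [Measure.ae_ennreal_smul_measure_iff (by simpa using hf.right_pos), ae_dirac_eq] at h₃
  refine ⟨h₁, ?_, h₃⟩
  rw [ae_withDensity_iff hf.measurable.ennreal_ofReal] at h₂
  filter_upwards [h₂, ae_restrict_mem measurableSet_Ioo] with x hx hx'
  exact hx (by simpa using hf.pos_of_mem hx')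

end Cells

/-! ### Solutions of the minimax problem -/

/-- The representer of `f_{H₁} - f_{H₂}` in `L²` of the cell measure. -/
noncomputable def ratioDiff (M : ℝ) (fbar : ℝ → ℝ) (H₁ H₂ : Measure ℝ) : ℝ → ℝ :=
  cellRatio M fbar fun x => marginalDensity H₁ x - marginalDensity H₂ x

lemma norm_toLp_sq {μ : Measure ℝ} {f : ℝ → ℝ} (hf : MemLp f 2 μ) :
    ‖hf.toLp f‖ ^ 2 = ∫ x, f x ^ 2 ∂μ := by
  rw [← real_inner_self_eq_norm_sq, L2.inner_def]
  refine integral_congr_ae ?_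
  filter_upwards [hf.coeFn_toLp] with x hx
  rw [hx]
  simp [pow_two]

lemma inner_toLp {μ : Measure ℝ} {f g : ℝ → ℝ} (hf : MemLp f 2 μ) (hg : MemLp g 2 μ) :
    inner ℝ (hf.toLp f) (hg.toLp g) = ∫ x, f x * g x ∂μ := by
  rw [L2.inner_def]
  refine integral_congr_ae ?_
  filter_upwards [hf.coeFn_toLp, hg.coeFn_toLp] with x hx hx'
  rw [hx, hx']
  simp [mul_comm]

lemma measurable_densityDiff (H₁ H₂ : Measure ℝ) [IsFiniteMeasure H₁] [IsFiniteMeasure H₂] :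
    Measurable fun x => marginalDensity H₁ x - marginalDensity H₂ x :=
  (measurable_marginalDensity H₁).sub (measurable_marginalDensity H₂)

section Pilot

variable {M κ : ℝ} {fbar : ℝ → ℝ}

lemma measurable_ratioDiff (hf : Measurable fbar) (H₁ H₂ : Measure ℝ) [IsFiniteMeasure H₁]
    [IsFiniteMeasure H₂] : Measurable (ratioDiff M fbar H₁ H₂) :=
  measurable_cellRatio hf (measurable_densityDiff H₁ H₂)

lemma ratioDiff_of_le {H₁ H₂ : Measure ℝ} {x : ℝ} (hx : x ≤ -M) :
    ratioDiff M fbar H₁ H₂ x = ratioDiff M fbar H₁ H₂ (-M) := by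
  unfold ratioDiff
  rw [cellRatio_of_le hx, cellRatio_of_le le_rfl]

lemma ratioDiff_of_ge (hM : 0 < M) {H₁ H₂ : Measure ℝ} {x : ℝ} (hx : M ≤ x) :
    ratioDiff M fbar H₁ H₂ x = ratioDiff M fbar H₁ H₂ M := by
  unfold ratioDiff
  rw [cellRatio_of_ge hM hx, cellRatio_of_ge hM le_rfl]

/-- The representer is affine along mixtures of pairs. -/
lemma ratioDiff_mix {H₁ H₂ K₁ K₂ : Measure ℝ} [IsProbabilityMeasure H₁]
    [IsProbabilityMeasure H₂] [IsProbabilityMeasure K₁] [IsProbabilityMeasure K₂] (a b : ℝ≥0)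
    (x : ℝ) :
    ratioDiff M fbar (a • H₁ + b • K₁) (a • H₂ + b • K₂) x =
      a * ratioDiff M fbar H₁ H₂ x + b * ratioDiff M fbar K₁ K₂ x := by
  have hint : ∀ S : Set ℝ,
      ∫ y in S, (marginalDensity (a • H₁ + b • K₁) y - marginalDensity (a • H₂ + b • K₂) y) =
        a * (∫ y in S, (marginalDensity H₁ y - marginalDensity H₂ y))
        + b * (∫ y in S, (marginalDensity K₁ y - marginalDensity K₂ y)) := fun S => by
    rw [← integral_const_mul, ← integral_const_mul, ← integral_add]
    · refine integral_congr_ae (ae_of_all _ fun y => ?_)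
      simp only [marginalDensity_add_smul]
      ring
    · exact ((integrable_marginalDensity H₁).integrableOn.sub
        (integrable_marginalDensity H₂).integrableOn).const_mul _
    · exact ((integrable_marginalDensity K₁).integrableOn.sub
        (integrable_marginalDensity K₂).integrableOn).const_mul _
  unfold ratioDiff cellRatio
  split_ifs
  · rw [hint]; ring
  · rw [hint]; ring
  · simp only [marginalDensity_add_smul]; ring

lemma integral_sq_ratioDiff (hM : 0 < M) (hf : IsRegularPilot M κ fbar) {H₁ H₂ : Measure ℝ}
    [IsProbabilityMeasure H₁] [IsProbabilityMeasure H₂] {b : ℝ}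
    (hb : ∀ x, |ratioDiff M fbar H₁ H₂ x| ≤ b) :
    ∫ x, ratioDiff M fbar H₁ H₂ x ^ 2 ∂(cellMeasure M fbar) = sqDist M fbar H₁ H₂ :=
  hf.integral_sq_cellRatio hM (measurable_densityDiff H₁ H₂) hb

lemma IsAdmissible.memLp (hM : 0 < M) (hf : IsRegularPilot M κ fbar) {m : ℕ} {𝒢m : Set (Measure ℝ)}
    {Γ : ℝ} {q : ℝ → ℝ} (hq : IsAdmissible M m fbar 𝒢m Γ q) :
    MemLp q 2 (cellMeasure M fbar) ∧
      ∫ x, q x ^ 2 * fbar x = ∫ x, q x ^ 2 ∂(cellMeasure M fbar) := by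
  have hi : Integrable (fun x => q x ^ 2) (cellMeasure M fbar) :=
    hf.integrable_cellMeasure_iff.2 hq.integrable_sq.integrableOn
  refine ⟨(memLp_two_iff_integrable_sq hq.measurable.aestronglyMeasurable).2 hi,
    (hf.integral_mul_pilot hM ?_ ?_ hi).2⟩
  · intro x hx
    simp only [hq.const_left x hx]
  · intro x hx
    simp only [hq.const_right x hx]

lemma integral_sub_integral_marginalLaw (hM : 0 < M) (hf : IsRegularPilot M κ fbar)
    {H₁ H₂ : Measure ℝ} [IsProbabilityMeasure H₁] [IsProbabilityMeasure H₂] {q : ℝ → ℝ}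
    (hl : ∀ x ≤ -M, q x = q (-M)) (hr : ∀ x ≥ M, q x = q M)
    (h₁ : Integrable q (marginalLaw H₁)) (h₂ : Integrable q (marginalLaw H₂))
    (hq : Integrable (fun x => q x * ratioDiff M fbar H₁ H₂ x) (cellMeasure M fbar)) :
    (∫ x, q x ∂(marginalLaw H₁)) - ∫ x, q x ∂(marginalLaw H₂) =
      ∫ x, q x * ratioDiff M fbar H₁ H₂ x ∂(cellMeasure M fbar) := by
  rw [integrable_marginalLaw_iff] at h₁ h₂
  rw [integral_marginalLaw, integral_marginalLaw, ← integral_sub h₁ h₂]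
  refine Eq.trans ?_ (hf.integral_mul_cellRatio hM hl hr ?_ ?_ hq).2
  · simp only [mul_sub]
  · exact (integrable_marginalDensity H₁).integrableOn.sub
      (integrable_marginalDensity H₂).integrableOn
  · exact (integrable_marginalDensity H₁).integrableOn.sub
      (integrable_marginalDensity H₂).integrableOn

lemma le_modulus {ψ : ℝ → ℝ} {𝒢m : Set (Measure ℝ)} {C : ℝ} (hC : ∀ H ∈ 𝒢m, |linFun ψ H| ≤ C)
    {H₁ H₂ : Measure ℝ} (h₁ : H₁ ∈ 𝒢m) (h₂ : H₂ ∈ 𝒢m) {t : ℝ} (ht : sqDist M fbar H₁ H₂ ≤ t ^ 2) :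
    linFun ψ H₁ - linFun ψ H₂ ≤ modulus ψ M fbar 𝒢m t := by
  refine le_csSup ⟨2 * C, ?_⟩ ⟨H₁, h₁, H₂, h₂, ht, rfl⟩
  rintro r ⟨K₁, k₁, K₂, k₂, -, rfl⟩
  have := abs_le.1 (hC K₁ k₁)
  have := abs_le.1 (hC K₂ k₂)
  linarith

/-- A function whose values differ by at most `D` stays within `D / 2` of some point. -/
lemma exists_abs_sub_le_half {α : Type*} {S : Set α} (hS : S.Nonempty) {g : α → ℝ} {D : ℝ}
    (h : ∀ x ∈ S, ∀ y ∈ S, g x - g y ≤ D) : ∃ q₀ : ℝ, ∀ x ∈ S, |q₀ - g x| ≤ D / 2 := by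
  obtain ⟨x₀, hx₀⟩ := hS
  have hbdd : BddAbove (g '' S) := ⟨g x₀ + D, by
    rintro _ ⟨y, hy, rfl⟩
    linarith [h y hy x₀ hx₀]⟩
  refine ⟨sSup (g '' S) - D / 2, fun x hx => ?_⟩
  have h₁ : g x ≤ sSup (g '' S) := le_csSup hbdd ⟨x, hx, rfl⟩
  have h₂ : sSup (g '' S) ≤ g x + D := by
    refine csSup_le ⟨_, x₀, hx₀, rfl⟩ ?_
    rintro _ ⟨y, hy, rfl⟩
    linarith [h y hy x hx]
  rw [abs_le]
  constructor <;> linarith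

lemma sq_le_of_worstSqBias_le {ψ : ℝ → ℝ} {𝒢m : Set (Measure ℝ)} {q₀ : ℝ} {q : ℝ → ℝ} {B : ℝ}
    (hB : 0 ≤ B) (h : worstSqBias ψ 𝒢m q₀ q ≤ ENNReal.ofReal (B ^ 2)) {H : Measure ℝ}
    (hH : H ∈ 𝒢m) : |q₀ + (∫ x, q x ∂(marginalLaw H)) - linFun ψ H| ≤ B := by
  have h1 := (le_iSup₂ (f := fun H (_ : H ∈ 𝒢m) =>
    ENNReal.ofReal ((q₀ + (∫ x, q x ∂(marginalLaw H)) - linFun ψ H) ^ 2)) H hH).trans h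
  rw [ENNReal.ofReal_le_ofReal_iff (sq_nonneg _)] at h1
  exact abs_le_of_sq_le_sq h1 hB

/-- Solution of the minimax problem. If the modulus problem at `δ` is attained at `(H₁, H₂)` and
the modulus has a positive supergradient `s` at `δ`, then `(s / δ) • ratioDiff M fbar H₁ H₂` is a
solution for the variance budget `s² / m`, and every solution coincides with it almost everywhere.
The pair `(H₁, H₂)` alone forces a squared bias of at least `((ω(δ) - s δ) / 2)²` through the
Cauchy-Schwarz inequality, the Lagrange inequality shows that the explicit solution attains this
bound, and equality in Cauchy-Schwarz gives uniqueness. -/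
lemma minimaxSolution_eq (hM : 0 < M) (hf : IsRegularPilot M κ fbar) {𝒢m : Set (Measure ℝ)}
    (hprob : ∀ H ∈ 𝒢m, IsProbabilityMeasure H) (hconv : Convex ℝ≥0 𝒢m)
    {ψ : ℝ → ℝ} (hψ : ∀ H ∈ 𝒢m, Integrable ψ H) {C : ℝ} (hC : ∀ H ∈ 𝒢m, |linFun ψ H| ≤ C)
    {b : ℝ} (hb : ∀ H₁ ∈ 𝒢m, ∀ H₂ ∈ 𝒢m, ∀ x, |ratioDiff M fbar H₁ H₂ x| ≤ b)
    {m : ℕ} (hm : 0 < m) {δ s : ℝ} (hδ : 0 < δ) (hs : 0 < s)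
    (hsup : IsSupergradient (modulus ψ M fbar 𝒢m) δ s) (hatt : ModulusAttained ψ M fbar 𝒢m δ) :
    ∃ H₁ ∈ 𝒢m, ∃ H₂ ∈ 𝒢m,
      (∫ x, ratioDiff M fbar H₁ H₂ x ^ 2 ∂(cellMeasure M fbar) = δ ^ 2) ∧
      (∃ q₀ q, IsMinimaxSolution ψ M m fbar 𝒢m (s ^ 2 / m) q₀ q) ∧
      ∀ q₀ q, IsMinimaxSolution ψ M m fbar 𝒢m (s ^ 2 / m) q₀ q →
        q =ᵐ[cellMeasure M fbar] (fun x => s / δ * ratioDiff M fbar H₁ H₂ x) ∧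
        worstSqBias ψ 𝒢m q₀ q ≠ ⊤ := by
  obtain ⟨H₁, h₁, H₂, h₂, hd, hL⟩ := hatt
  set w := modulus ψ M fbar 𝒢m with hw
  have hfin := hf.isFiniteMeasure
  have hmem : ∀ K₁ ∈ 𝒢m, ∀ K₂ ∈ 𝒢m, MemLp (ratioDiff M fbar K₁ K₂) 2 (cellMeasure M fbar) :=
    fun K₁ k₁ K₂ k₂ => by
      have := hprob K₁ k₁
      have := hprob K₂ k₂
      exact hf.memLp_of_bounded (measurable_ratioDiff hf.measurable K₁ K₂) (hb K₁ k₁ K₂ k₂)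
  have hnorm : ∀ K₁ (k₁ : K₁ ∈ 𝒢m) K₂ (k₂ : K₂ ∈ 𝒢m),
      ‖(hmem K₁ k₁ K₂ k₂).toLp‖ ^ 2 = sqDist M fbar K₁ K₂ := fun K₁ k₁ K₂ k₂ => by
    have := hprob K₁ k₁
    have := hprob K₂ k₂
    rw [norm_toLp_sq, integral_sq_ratioDiff hM hf (hb K₁ k₁ K₂ k₂)]
  have hmod : ∀ K₁ (k₁ : K₁ ∈ 𝒢m) K₂ (k₂ : K₂ ∈ 𝒢m) (t : ℝ), 0 < t →
      ‖(hmem K₁ k₁ K₂ k₂).toLp‖ ≤ t → linFun ψ K₁ - linFun ψ K₂ ≤ w t :=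
    fun K₁ k₁ K₂ k₂ t ht h => by
      refine le_modulus hC k₁ k₂ ?_
      rw [← hnorm K₁ k₁ K₂ k₂]
      gcongr
  set v₀ := (hmem H₁ h₁ H₂ h₂).toLp with hv₀
  have hv₀δ : ‖v₀‖ = δ := by
    refine norm_eq_of_supergradient hδ hs hsup ?_ fun t ht h => ?_
    · rw [← hnorm H₁ h₁ H₂ h₂] at hd
      exact (sq_le_sq₀ (norm_nonneg _) hδ.le).1 hd
    · rw [← hL]
      exact hmod H₁ h₁ H₂ h₂ t ht h
  have hlag : ∀ K₁ (k₁ : K₁ ∈ 𝒢m) K₂ (k₂ : K₂ ∈ 𝒢m), (linFun ψ K₁ - linFun ψ K₂)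
      - (s / δ) * inner ℝ v₀ (hmem K₁ k₁ K₂ k₂).toLp ≤ w δ - s * δ := by
    intro K₁ k₁ K₂ k₂
    have := hprob K₁ k₁
    have := hprob K₂ k₂
    have := hprob H₁ h₁
    have := hprob H₂ h₂
    refine sub_inner_le_of_supergradient hδ hsup hv₀δ fun r hr t ht hle => ?_
    set a' : ℝ≥0 := ⟨1 - r, by linarith [hr.2]⟩ with ha'
    set r' : ℝ≥0 := ⟨r, hr.1.le⟩ with hr'
    have hsum : a' + r' = 1 := by
      refine NNReal.eq ?_
      rw [NNReal.coe_add, NNReal.coe_one]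
      exact sub_add_cancel 1 r
    have ea : (a' : ℝ) = 1 - r := rfl
    have er : (r' : ℝ) = r := rfl
    have m₁ : a' • H₁ + r' • K₁ ∈ 𝒢m := hconv h₁ k₁ zero_le zero_le hsum
    have m₂ : a' • H₂ + r' • K₂ ∈ 𝒢m := hconv h₂ k₂ zero_le zero_le hsum
    have e : (hmem _ m₁ _ m₂).toLp = v₀ + r • ((hmem K₁ k₁ K₂ k₂).toLp - v₀) := by
      rw [hv₀, ← MemLp.toLp_sub, ← MemLp.toLp_const_smul, ← MemLp.toLp_add]
      refine MemLp.toLp_congr _ _ (ae_of_all _ fun x => ?_)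
      rw [ratioDiff_mix, ea, er]
      simp
      ring
    rw [← e] at hle
    refine le_trans (le_of_eq ?_) (hmod _ m₁ _ m₂ t ht hle)
    rw [linFun_add_smul (hψ _ h₁) (hψ _ k₁), linFun_add_smul (hψ _ h₂) (hψ _ k₂), ← hL, ea, er]
    ring
  -- The pair `(H₁, H₂)` itself bounds the bias of every admissible weighting from below.
  have hlower : ∀ r₀ r, IsAdmissible M m fbar 𝒢m (s ^ 2 / m) r →
      ∃ hr : MemLp r 2 (cellMeasure M fbar), ‖hr.toLp‖ ≤ s ∧ w δ - inner ℝ hr.toLp v₀ ≤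
        |r₀ + (∫ x, r x ∂(marginalLaw H₁)) - linFun ψ H₁| +
        |r₀ + (∫ x, r x ∂(marginalLaw H₂)) - linFun ψ H₂| := by
    intro r₀ r hr
    have := hprob H₁ h₁
    have := hprob H₂ h₂
    obtain ⟨hr2, hsq⟩ := hr.memLp hM hf
    refine ⟨hr2, ?_, ?_⟩
    · have h1 := hr.variance_le
      rw [div_le_div_iff_of_pos_right (by exact_mod_cast hm), hsq, ← norm_toLp_sq hr2] at h1
      exact (sq_le_sq₀ (norm_nonneg _) hs.le).1 h1
    · have hi := integral_sub_integral_marginalLaw hM hf hr.const_left hr.const_right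
        (hr.integrable H₁ h₁) (hr.integrable H₂ h₂) (hr2.integrable_mul (hmem H₁ h₁ H₂ h₂))
      rw [hv₀, inner_toLp, ← hi, ← hL]
      have := neg_abs_le (r₀ + (∫ x, r x ∂(marginalLaw H₁)) - linFun ψ H₁)
      have := le_abs_self (r₀ + (∫ x, r x ∂(marginalLaw H₂)) - linFun ψ H₂)
      linarith
  -- The Lagrange inequality at a pair of equal measures, whose representer is zero.
  have hD : 0 ≤ w δ - s * δ := by
    have h5 := hlag H₁ h₁ H₁ h₁
    have e : (hmem H₁ h₁ H₁ h₁).toLp = 0 := by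
      have := hnorm H₁ h₁ H₁ h₁
      have h0 : sqDist M fbar H₁ H₁ = 0 := by simp [sqDist]
      rw [h0] at this
      exact norm_eq_zero.1 (pow_eq_zero_iff two_ne_zero |>.1 this)
    rw [e] at h5
    simpa using h5
  set qs : ℝ → ℝ := fun x => s / δ * ratioDiff M fbar H₁ H₂ x with hqs
  have hqs_meas : Measurable qs := by
    have := hprob H₁ h₁
    have := hprob H₂ h₂
    exact (measurable_ratioDiff hf.measurable H₁ H₂).const_mul _
  have hqs_left : ∀ x ≤ -M, qs x = qs (-M) := fun x hx => by
    simp only [hqs, ratioDiff_of_le hx]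
  have hqs_right : ∀ x ≥ M, qs x = qs M := fun x hx => by
    simp only [hqs, ratioDiff_of_ge hM hx]
  have hqs_int : ∀ H ∈ 𝒢m, Integrable qs (marginalLaw H) := fun H hH => by
    have := hprob H hH
    have := isProbabilityMeasure_marginalLaw H
    refine Integrable.of_bound hqs_meas.aestronglyMeasurable (s / δ * b) (ae_of_all _ fun x => ?_)
    rw [hqs, Real.norm_eq_abs, abs_mul, abs_of_pos (by positivity)]
    have := hb H₁ h₁ H₂ h₂ x
    gcongr
  have hqs_mem : MemLp qs 2 (cellMeasure M fbar) := (hmem H₁ h₁ H₂ h₂).const_mul (s / δ)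
  have hqs_toLp : hqs_mem.toLp = (s / δ) • v₀ := by
    rw [hv₀, ← MemLp.toLp_const_smul]
    rfl
  have hqs_norm : ‖hqs_mem.toLp‖ = s := by
    rw [hqs_toLp, norm_smul, hv₀δ, Real.norm_of_nonneg (by positivity), div_mul_cancel₀ _ hδ.ne']
  have hqs_sq := hf.integral_mul_pilot hM (q := fun x => qs x ^ 2)
    (fun x hx => by simp only [hqs_left x hx]) (fun x hx => by simp only [hqs_right x hx])
    hqs_mem.integrable_sq
  have hqs_adm : IsAdmissible M m fbar 𝒢m (s ^ 2 / m) qs :=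
    ⟨hqs_meas, hqs_left, hqs_right, hqs_int, hqs_sq.1, by
      rw [hqs_sq.2, ← norm_toLp_sq hqs_mem, hqs_norm]⟩
  obtain ⟨q₀, hq₀⟩ : ∃ q₀ : ℝ, ∀ H ∈ 𝒢m,
      |q₀ - (linFun ψ H - ∫ x, qs x ∂(marginalLaw H))| ≤ (w δ - s * δ) / 2 := by
    refine exists_abs_sub_le_half ⟨H₁, h₁⟩ fun K₁ k₁ K₂ k₂ => ?_
    have := hprob K₁ k₁
    have := hprob K₂ k₂
    have hi := integral_sub_integral_marginalLaw hM hf hqs_left hqs_right (hqs_int K₁ k₁)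
      (hqs_int K₂ k₂) (hqs_mem.integrable_mul (hmem K₁ k₁ K₂ k₂))
    have h3 := hlag K₁ k₁ K₂ k₂
    rw [← real_inner_smul_left, ← hqs_toLp, inner_toLp, ← hi] at h3
    linarith
  have hupper : worstSqBias ψ 𝒢m q₀ qs ≤ ENNReal.ofReal (((w δ - s * δ) / 2) ^ 2) := by
    refine iSup₂_le fun H hH => ENNReal.ofReal_le_ofReal ?_
    have h3 := hq₀ H hH
    rw [← sq_abs]
    have : q₀ + (∫ x, qs x ∂(marginalLaw H)) - linFun ψ H =
      q₀ - (linFun ψ H - ∫ x, qs x ∂(marginalLaw H)) := by ring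
    rw [this]
    gcongr
  refine ⟨H₁, h₁, H₂, h₂, ?_, ⟨q₀, qs, hqs_adm, fun r₀ r hr => hupper.trans ?_⟩,
    fun r₀ r hr => ?_⟩
  · rw [← norm_toLp_sq (hmem H₁ h₁ H₂ h₂), ← hv₀, hv₀δ]
  · obtain ⟨hr2, hrs, hle⟩ := hlower r₀ r hr
    have hcs : inner ℝ hr2.toLp v₀ ≤ s * δ := by
      refine (real_inner_le_norm _ _).trans ?_
      rw [hv₀δ]
      gcongr
    -- One of the two biases is at least half of their sum.
    have hstep : ∀ K ∈ 𝒢m, (w δ - s * δ) / 2 ≤ |r₀ + (∫ x, r x ∂(marginalLaw K)) - linFun ψ K| →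
        ENNReal.ofReal (((w δ - s * δ) / 2) ^ 2) ≤ worstSqBias ψ 𝒢m r₀ r := fun K hK hKle => by
      refine le_trans (ENNReal.ofReal_le_ofReal ?_) (le_iSup₂ (f := fun H (_ : H ∈ 𝒢m) =>
        ENNReal.ofReal ((r₀ + (∫ x, r x ∂(marginalLaw H)) - linFun ψ H) ^ 2)) K hK)
      rw [← sq_abs (r₀ + (∫ x, r x ∂(marginalLaw K)) - linFun ψ K)]
      gcongr
    rcases le_total ((w δ - s * δ) / 2) |r₀ + (∫ x, r x ∂(marginalLaw H₁)) - linFun ψ H₁|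
      with h3 | h3
    · exact hstep H₁ h₁ h3
    · exact hstep H₂ h₂ (by linarith)
  · have hle' := (hr.2 q₀ qs hqs_adm).trans hupper
    refine ⟨?_, ne_top_of_le_ne_top ENNReal.ofReal_ne_top hle'⟩
    obtain ⟨hr2, hrs, hle⟩ := hlower r₀ r hr.1
    have b₁ := sq_le_of_worstSqBias_le (by linarith) hle' h₁
    have b₂ := sq_le_of_worstSqBias_le (by linarith) hle' h₂
    have heq := eq_smul_of_inner_ge hδ hs.le hrs hv₀δ (by linarith)
    rw [← hqs_toLp] at heq
    exact (MemLp.toLp_eq_toLp_iff hr2 hqs_mem).1 heq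

end Pilot

/-! ### Size of the minimax weighting on the localization event -/

/-- A constant `κ > 0` bounds from below the density `f_G` on `[-M, M]` and its tail integrals. -/
structure IsCellLowerBound (M : ℝ) (G : Measure ℝ) (κ : ℝ) : Prop where
  pos : 0 < κ
  le : ∀ x ∈ Icc (-M) M, κ ≤ marginalDensity G x
  le_left : κ ≤ ∫ x in Iic (-M), marginalDensity G x
  le_right : κ ≤ ∫ x in Ici M, marginalDensity G x

lemma exists_isCellLowerBound (G : Measure ℝ) [IsProbabilityMeasure G] (M : ℝ) :
    ∃ κ, IsCellLowerBound M G κ := by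
  have htail : ∀ S : Set ℝ, volume S ≠ 0 → 0 < ∫ x in S, marginalDensity G x := by
    intro S hS
    rw [setIntegral_pos_iff_support_of_nonneg_ae (ae_of_all _ (marginalDensity_nonneg G))
      (integrable_marginalDensity G).integrableOn]
    have : Function.support (marginalDensity G) = univ := by
      ext x
      simpa using (marginalDensity_pos G x).ne'
    rw [this, univ_inter]
    exact pos_iff_ne_zero.2 hS
  obtain ⟨κ, hκ, hle⟩ : ∃ κ : ℝ, 0 < κ ∧ ∀ x ∈ Icc (-M) M, κ ≤ marginalDensity G x := by
    rcases (Icc (-M) M).eq_empty_or_nonempty with he | hne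
    · exact ⟨1, one_pos, by simp [he]⟩
    · obtain ⟨x₀, -, hx₀⟩ := isCompact_Icc.exists_isMinOn hne
        (continuous_marginalDensity G).continuousOn
      exact ⟨_, marginalDensity_pos G x₀, hx₀⟩
  have hL := htail (Iic (-M)) (by simp)
  have hR := htail (Ici M) (by simp)
  refine ⟨min κ (min _ _), lt_min hκ (lt_min hL hR), fun x hx => (min_le_left _ _).trans (hle x hx),
    (min_le_right _ _).trans (min_le_left _ _), (min_le_right _ _).trans (min_le_right _ _)⟩

section Band

variable {M κ c : ℝ} {fbar : ℝ → ℝ} {G : Measure ℝ}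

lemma integral_band_eq [IsProbabilityMeasure G] {S : Set ℝ} (hS : IntegrableOn fbar S) :
    ∫ x in S, (marginalDensity G x - fbar x) =
      (∫ x in S, marginalDensity G x) - ∫ x in S, fbar x :=
  integral_sub (integrable_marginalDensity G).integrableOn hS

/-- Near `f_G`, the pilot inherits half of the lower bound on the cells. -/
lemma isRegularPilot_of_band [IsProbabilityMeasure G] (hκ : IsCellLowerBound M G κ)
    (hf : Measurable fbar) (hl : IntegrableOn fbar (Iic (-M))) (hr : IntegrableOn fbar (Ici M))
    (hband : normInfM M (fun x => marginalDensity G x - fbar x) ≤ (c : EReal)) (hc : c ≤ κ / 2) :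
    IsRegularPilot M (κ / 2) fbar := by
  rw [normInfM_le_iff, integral_band_eq hl, integral_band_eq hr] at hband
  obtain ⟨h₁, h₂, h₃⟩ := hband
  have hpos := hκ.pos
  refine ⟨hf, hl, hr, by linarith, fun x hx => ?_, ?_, ?_, ?_⟩
  · have := (abs_le.1 (h₁ x hx)).2
    have := hκ.le x hx
    linarith
  · obtain ⟨B, hB⟩ := isCompact_Icc.exists_bound_of_continuousOn (s := Icc (-M) M)
      (continuous_marginalDensity G).continuousOn
    refine ⟨B + c, fun x hx => ?_⟩
    have h4 := (abs_le.1 (h₁ x hx)).1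
    have h5 := (le_abs_self _).trans (hB x hx)
    linarith
  · have := (abs_le.1 h₂).2
    have := hκ.le_left
    linarith
  · have := (abs_le.1 h₃).2
    have := hκ.le_right
    linarith

/-- In the band, integration against `f_G` and against the cell measure differ by a factor close
to one. -/
lemma abs_integral_marginalLaw_sub_le [IsProbabilityMeasure G] (hM : 0 < M)
    (hf : IsRegularPilot M κ fbar)
    (hband : normInfM M (fun x => marginalDensity G x - fbar x) ≤ (c : EReal))
    {r : ℝ → ℝ} (hl : ∀ x ≤ -M, r x = r (-M)) (hr : ∀ x ≥ M, r x = r M)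
    (hr_int : Integrable r (cellMeasure M fbar)) :
    Integrable r (marginalLaw G) ∧
    |(∫ x, r x ∂(marginalLaw G)) - ∫ x, r x ∂(cellMeasure M fbar)| ≤
      c / κ * ∫ x, |r x| ∂(cellMeasure M fbar) := by
  set d := cellRatio M fbar (fun x => marginalDensity G x - fbar x) with hd
  have hdb : ∀ x, |d x| ≤ c / κ := hf.abs_cellRatio_le (normInfM_le_iff.1 hband)
  have hdm : Measurable d := measurable_cellRatio hf.measurable
    ((measurable_marginalDensity G).sub hf.measurable)
  have hT : ∀ x, cellRatio M fbar (marginalDensity G) x = 1 + d x := by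
    intro x
    have h1 := hf.left_pos.ne'
    have h2 := hf.right_pos.ne'
    rw [hd]
    unfold cellRatio
    split_ifs with h₁ h₂
    · rw [integral_band_eq hf.integrableOn_left]
      field_simp
      ring
    · rw [integral_band_eq hf.integrableOn_right]
      field_simp
      ring
    · have := (hf.pos_of_mem ⟨not_le.1 h₁, not_le.1 h₂⟩).ne'
      field_simp
      ring
  have hrd : Integrable (fun x => r x * d x) (cellMeasure M fbar) :=
    hr_int.mul_bdd (c := c / κ) hdm.aestronglyMeasurable (ae_of_all _ hdb)
  have hrT : (fun x => r x * cellRatio M fbar (marginalDensity G) x) =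
      fun x => r x + r x * d x := by
    ext x
    rw [hT]
    ring
  obtain ⟨hi, he⟩ := hf.integral_mul_cellRatio hM hl hr
    (integrable_marginalDensity G).integrableOn (integrable_marginalDensity G).integrableOn
    (by rw [hrT]; exact hr_int.add hrd)
  refine ⟨(integrable_marginalLaw_iff G r).2 hi, ?_⟩
  rw [integral_marginalLaw, he, hrT, integral_add hr_int hrd, add_sub_cancel_left,
    ← integral_const_mul]
  refine (norm_integral_le_integral_norm _).trans
    (integral_mono hrd.norm (hr_int.abs.const_mul _) fun x => ?_)
  simp only [norm_mul, Real.norm_eq_abs]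
  rw [mul_comm]
  exact mul_le_mul_of_nonneg_right (hdb x) (abs_nonneg _)

lemma abs_ratioDiff_le {𝒢 : Set (Measure ℝ)} (hprob : ∀ H ∈ 𝒢, IsProbabilityMeasure H)
    (hf : IsRegularPilot M κ fbar) {H₁ H₂ : Measure ℝ} (h₁ : H₁ ∈ localClass 𝒢 M fbar c)
    (h₂ : H₂ ∈ localClass 𝒢 M fbar c) (x : ℝ) :
    |ratioDiff M fbar H₁ H₂ x| ≤ 2 * c / κ := by
  have := hprob H₁ h₁.1
  have := hprob H₂ h₂.1
  have n₁ := normInfM_le_iff.1 h₁.2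
  have n₂ := normInfM_le_iff.1 h₂.2
  have aux : ∀ u v w : ℝ, |u - w| ≤ c → |v - w| ≤ c → |u - v| ≤ 2 * c := fun u v w hu hv => by
    rw [abs_le] at *
    constructor <;> linarith
  have i := fun (H : Measure ℝ) (_ : IsProbabilityMeasure H) => integrable_marginalDensity H
  rw [integral_band_eq hf.integrableOn_left, integral_band_eq hf.integrableOn_right] at n₁ n₂
  refine hf.abs_cellRatio_le ⟨fun y hy => aux _ _ _ (n₁.1 y hy) (n₂.1 y hy), ?_, ?_⟩ x
  · rw [integral_sub (i H₁ ‹_›).integrableOn (i H₂ ‹_›).integrableOn]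
    exact aux _ _ _ n₁.2.1 n₂.2.1
  · rw [integral_sub (i H₁ ‹_›).integrableOn (i H₂ ‹_›).integrableOn]
    exact aux _ _ _ n₁.2.2 n₂.2.2

/-- What the limit theorems need to know about the offset `q₀` and the weighting `q`: for a small
`ε`, the weighting has `∫ q² fbar = s²`, sup norm at most `2 ε s / δ`, and under the law `ν` of an
observation a second moment within `ε s²` of `s²` and a first moment of order `ε s`. -/
structure WeightingEstimates (ν : Measure ℝ) (fbar : ℝ → ℝ) (δ ε s : ℝ) (q : ℝ → ℝ) : Prop where
  pos : 0 < s
  eps_nonneg : 0 ≤ ε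
  integral_sq : ∫ x, q x ^ 2 * fbar x = s ^ 2
  bound : ∀ᵐ x ∂ν, |q x| ≤ 2 * ε * s / δ
  second_moment : |(∫ x, q x ^ 2 ∂ν) - s ^ 2| ≤ ε * s ^ 2
  first_moment : |∫ x, q x ∂ν| ≤ 2 * ε * s

/-- On the localization event with a small radius, the minimax problem has a solution, and every
solution has the size required by the limit theorems and a worst-case bias that covers the bias
at `G`. The first moment is small because the solution is a multiple of the representer of a
difference of two densities, and thus integrates to zero against `fbar`. -/
lemma minimaxSolution_estimates (hM : 0 < M) {𝒢 : Set (Measure ℝ)}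
    (hprob : ∀ H ∈ 𝒢, IsProbabilityMeasure H) (hconv : Convex ℝ≥0 𝒢) (hG : G ∈ 𝒢)
    {ψ : ℝ → ℝ} (hψ : ∀ H ∈ 𝒢, Integrable ψ H) {C : ℝ} (hC : ∀ H ∈ 𝒢, |linFun ψ H| ≤ C)
    (hκ : IsCellLowerBound M G κ)
    (hf : Measurable fbar) (hl : IntegrableOn fbar (Iic (-M))) (hr : IntegrableOn fbar (Ici M))
    (hband : normInfM M (fun x => marginalDensity G x - fbar x) ≤ (c : EReal)) (hc : c ≤ κ / 4)
    {m : ℕ} (hm : 0 < m) {δ s : ℝ} (hδ : 0 < δ) (hs : 0 < s)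
    (hsup : IsSupergradient (modulus ψ M fbar (localClass 𝒢 M fbar c)) δ s)
    (hatt : ModulusAttained ψ M fbar (localClass 𝒢 M fbar c) δ) :
    (∃ q₀ q, IsMinimaxSolution ψ M m fbar (localClass 𝒢 M fbar c) (s ^ 2 / m) q₀ q) ∧
    ∀ q₀ q, IsMinimaxSolution ψ M m fbar (localClass 𝒢 M fbar c) (s ^ 2 / m) q₀ q →
      WeightingEstimates (marginalLaw G) fbar δ (2 * c / κ) s q ∧
      |q₀ + (∫ x, q x ∂(marginalLaw G)) - linFun ψ G| ≤
        biasBound ψ (localClass 𝒢 M fbar c) q₀ q := by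
  have := hprob G hG
  have hGm : G ∈ localClass 𝒢 M fbar c := ⟨hG, hband⟩
  have hc0 : 0 ≤ c := (abs_nonneg _).trans (normInfM_le_iff.1 hband).2.1
  have hκ0 := hκ.pos
  have hreg := isRegularPilot_of_band hκ hf hl hr hband (by linarith)
  have hfin := hreg.isFiniteMeasure
  have hε : c / (κ / 2) = 2 * c / κ := by field_simp
  have hε2 : 2 * c / κ ≤ 1 / 2 := by
    rw [div_le_iff₀ hκ0]
    linarith
  have hε0 : 0 ≤ 2 * c / κ := by positivity
  obtain ⟨H₁, h₁, H₂, h₂, hsq, hex, huniq⟩ := minimaxSolution_eq hM hreg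
    (fun H hH => hprob H hH.1) (convex_localClass hprob hconv hl hr) (fun H hH => hψ H hH.1)
    (fun H hH => hC H hH.1) (fun H₁ h₁ H₂ h₂ => abs_ratioDiff_le hprob hreg h₁ h₂) hm hδ hs hsup
    hatt
  refine ⟨hex, fun q₀ q hq => ?_⟩
  obtain ⟨hae, htop⟩ := huniq q₀ q hq
  obtain ⟨hq2, hq2e⟩ := hq.1.memLp hM hreg
  have := hprob H₁ h₁.1
  have := hprob H₂ h₂.1
  have hint_sq : ∫ x, q x ^ 2 ∂(cellMeasure M fbar) = s ^ 2 := by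
    have h : (fun x => q x ^ 2) =ᵐ[cellMeasure M fbar]
        fun x => (s / δ) ^ 2 * ratioDiff M fbar H₁ H₂ x ^ 2 := by
      filter_upwards [hae] with x hx
      rw [hx]
      ring
    rw [integral_congr_ae h, integral_const_mul, hsq]
    field_simp
  have hint : ∫ x, q x ∂(cellMeasure M fbar) = 0 := by
    have hT : Integrable (fun x => (1 : ℝ) * ratioDiff M fbar H₁ H₂ x) (cellMeasure M fbar) := by
      refine hreg.integrable_of_bounded (b := 2 * c / (κ / 2)) ?_ fun x => ?_
      · exact (measurable_ratioDiff hf H₁ H₂).const_mul 1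
      · rw [one_mul]
        exact abs_ratioDiff_le hprob hreg h₁ h₂ x
    have h := (hreg.integral_mul_cellRatio hM (q := fun _ => 1)
      (h := fun x => marginalDensity H₁ x - marginalDensity H₂ x) (fun _ _ => rfl) (fun _ _ => rfl)
      ((integrable_marginalDensity H₁).integrableOn.sub
        (integrable_marginalDensity H₂).integrableOn)
      ((integrable_marginalDensity H₁).integrableOn.sub
        (integrable_marginalDensity H₂).integrableOn) hT).2
    simp only [one_mul] at h
    rw [integral_sub (integrable_marginalDensity H₁) (integrable_marginalDensity H₂),
      integral_marginalDensity, integral_marginalDensity, sub_self] at h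
    rw [integral_congr_ae hae, integral_const_mul]
    change s / δ * (∫ x, cellRatio M fbar _ x ∂_) = 0
    rw [← h, mul_zero]
  have hmass : ∫ _, (1 : ℝ) ∂(cellMeasure M fbar) ≤ 2 := by
    have h := (abs_integral_marginalLaw_sub_le (G := G) hM hreg hband (r := fun _ => 1)
      (fun _ _ => rfl) (fun _ _ => rfl) (integrable_const _)).2
    have := isProbabilityMeasure_marginalLaw G
    have h1 : ∫ _, (1 : ℝ) ∂(marginalLaw G) = 1 := by simp
    rw [h1, abs_one, hε] at h
    have h0 : 0 ≤ ∫ _, (1 : ℝ) ∂(cellMeasure M fbar) := integral_nonneg fun _ => zero_le_one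
    have := (abs_le.1 h).1
    nlinarith
  have hL1 : ∫ x, |q x| ∂(cellMeasure M fbar) ≤ 2 * s := by
    -- Integrate `|q| ≤ (s + q² / s) / 2`.
    have hle : ∫ x, |q x| ∂(cellMeasure M fbar) ≤
        ∫ x, (s / 2 * 1 + 1 / (2 * s) * q x ^ 2) ∂(cellMeasure M fbar) := by
      refine integral_mono (hq2.integrable one_le_two).abs
        (((integrable_const _).const_mul _).add (hq2.integrable_sq.const_mul _)) fun x => ?_
      have : s / 2 * 1 + 1 / (2 * s) * q x ^ 2 = (s ^ 2 + |q x| ^ 2) / (2 * s) := by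
        rw [sq_abs]
        field_simp
      simp only [this]
      rw [le_div_iff₀ (by positivity)]
      nlinarith [sq_nonneg (s - |q x|)]
    rw [integral_add ((integrable_const _).const_mul _) (hq2.integrable_sq.const_mul _),
      integral_const_mul, integral_const_mul, hint_sq] at hle
    have : 1 / (2 * s) * s ^ 2 = s / 2 := by field_simp
    nlinarith
  have hsq_left : ∀ x ≤ -M, q x ^ 2 = q (-M) ^ 2 := fun x hx => by rw [hq.1.const_left x hx]
  have hsq_right : ∀ x ≥ M, q x ^ 2 = q M ^ 2 := fun x hx => by rw [hq.1.const_right x hx]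
  refine ⟨⟨hs, hε0, hq2e.trans hint_sq, ?_, ?_, ?_⟩, ?_⟩
  · have hb : ∀ᵐ x ∂(cellMeasure M fbar), |q x| ≤ 2 * (2 * c / κ) * s / δ := by
      filter_upwards [hae] with x hx
      have := abs_ratioDiff_le hprob hreg h₁ h₂ x
      rw [hx, abs_mul, abs_of_pos (by positivity)]
      calc s / δ * |ratioDiff M fbar H₁ H₂ x| ≤ s / δ * (2 * c / (κ / 2)) := by gcongr
        _ = _ := by field_simp
    obtain ⟨b₁, b₂, b₃⟩ := hreg.ae_volume_of_ae_cellMeasure hb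
    refine (withDensity_absolutelyContinuous _ _ : marginalLaw G ≪ volume).ae_le ?_
    rw [ae_restrict_iff' measurableSet_Ioo] at b₂
    filter_upwards [b₂] with x hx
    rcases le_or_gt x (-M) with h | h
    · rwa [hq.1.const_left x h]
    · rcases le_or_gt M x with h' | h'
      · rwa [hq.1.const_right x h']
      · exact hx ⟨h, h'⟩
  · have h := (abs_integral_marginalLaw_sub_le (G := G) hM hreg hband (r := fun x => q x ^ 2)
      hsq_left hsq_right hq2.integrable_sq).2
    simp only [abs_pow, sq_abs] at h
    rwa [hint_sq, hε] at h
  · have h := (abs_integral_marginalLaw_sub_le (G := G) hM hreg hband hq.1.const_left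
      hq.1.const_right (hq2.integrable one_le_two)).2
    rw [hint, sub_zero, hε] at h
    refine h.trans ?_
    calc 2 * c / κ * ∫ x, |q x| ∂(cellMeasure M fbar) ≤ 2 * c / κ * (2 * s) := by gcongr
      _ = _ := by ring
  · unfold biasBound
    refine Real.abs_le_sqrt ?_
    rw [← ENNReal.ofReal_le_iff_le_toReal htop]
    exact le_iSup₂ (f := fun H (_ : H ∈ localClass 𝒢 M fbar c) =>
      ENNReal.ofReal ((q₀ + (∫ x, q x ∂(marginalLaw H)) - linFun ψ H) ^ 2)) G hGm

end Band

/-! ### A quantitative central limit theorem for bounded variables -/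

lemma norm_pow_sub_pow_le_of_norm_le_one {a b : ℂ} (ha : ‖a‖ ≤ 1) (hb : ‖b‖ ≤ 1) (n : ℕ) :
    ‖a ^ n - b ^ n‖ ≤ n * ‖a - b‖ := by
  induction n with
  | zero => simp
  | succ n ih =>
    have h : a ^ (n + 1) - b ^ (n + 1) = a * (a ^ n - b ^ n) + (a - b) * b ^ n := by ring
    rw [h]
    refine (norm_add_le _ _).trans ?_
    rw [norm_mul, norm_mul, norm_pow]
    have h1 : ‖a‖ * ‖a ^ n - b ^ n‖ ≤ 1 * (n * ‖a - b‖) := by gcongr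
    have h2 : ‖a - b‖ * ‖b‖ ^ n ≤ ‖a - b‖ * 1 := by
      gcongr
      exact pow_le_one₀ (norm_nonneg _) hb
    push_cast
    linarith

lemma norm_cexp_sub_taylor_two_le {y : ℝ} (hy : |y| ≤ 1) :
    ‖Complex.exp (y * Complex.I) - (1 + y * Complex.I - y ^ 2 / 2)‖ ≤ |y| ^ 3 := by
  have hn : ‖(y : ℂ) * Complex.I‖ = |y| := by simp
  have h := Complex.exp_bound (x := y * Complex.I) (by rwa [hn]) (n := 3) (by norm_num)
  rw [hn] at h
  have e : ∑ m ∈ Finset.range 3, ((y : ℂ) * Complex.I) ^ m / (m.factorial : ℂ) =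
      1 + y * Complex.I - y ^ 2 / 2 := by
    simp [Finset.sum_range_succ, mul_pow, Nat.factorial]
    ring
  rw [e] at h
  refine h.trans ?_
  have : |y| ^ 3 * ((Nat.succ 3 : ℝ) * ((Nat.factorial 3 : ℝ) * (3 : ℕ))⁻¹) ≤ |y| ^ 3 * 1 := by
    gcongr
    norm_num [Nat.factorial]
  simpa using this

section Standardized

variable {ν : Measure ℝ} [IsProbabilityMeasure ν] {Y : ℝ → ℝ} {K : ℝ}

lemma one_le_of_integral_sq_eq_one (h₂ : ∫ x, Y x ^ 2 ∂ν = 1) (hK0 : 0 ≤ K)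
    (hK : ∀ᵐ x ∂ν, |Y x| ≤ K) : 1 ≤ K := by
  have hi : Integrable (fun x => Y x ^ 2) ν := by
    by_contra h
    rw [integral_undef h] at h₂
    exact zero_ne_one h₂
  have h : ∫ x, Y x ^ 2 ∂ν ≤ ∫ _, K ^ 2 ∂ν := by
    refine integral_mono_ae hi (integrable_const _) ?_
    filter_upwards [hK] with x hx
    rw [← sq_abs]
    gcongr
  rw [h₂] at h
  simp only [integral_const, probReal_univ, one_smul] at h
  nlinarith

lemma norm_integral_cexp_sub_le (hY : Measurable Y) (h₁ : ∫ x, Y x ∂ν = 0)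
    (h₂ : ∫ x, Y x ^ 2 ∂ν = 1) (hK0 : 0 ≤ K) (hK : ∀ᵐ x ∂ν, |Y x| ≤ K) {u : ℝ}
    (hu : |u| * K ≤ 1) :
    ‖(∫ x, Complex.exp ((u * Y x : ℝ) * Complex.I) ∂ν) - Complex.exp (-(u ^ 2 / 2 : ℝ))‖ ≤
      2 * (|u| ^ 3 * K) := by
  have hK1 := one_le_of_integral_sq_eq_one h₂ hK0 hK
  have hYi : Integrable Y ν := Integrable.of_bound hY.aestronglyMeasurable K hK
  have hY2 : Integrable (fun x => Y x ^ 2) ν := by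
    by_contra h
    rw [integral_undef h] at h₂
    exact zero_ne_one h₂
  have hu1 : |u| ≤ 1 := by nlinarith [abs_nonneg u]
  have hexp : Integrable (fun x => Complex.exp ((u * Y x : ℝ) * Complex.I)) ν := by
    refine Integrable.of_bound (C := 1) (by fun_prop) (ae_of_all _ fun x => ?_)
    rw [Complex.norm_exp_ofReal_mul_I]
  have hpoly : ∀ x, (1 + ((u * Y x : ℝ) : ℂ) * Complex.I - ((u * Y x : ℝ) : ℂ) ^ 2 / 2) =
      1 + (Y x : ℂ) * (u * Complex.I) - ((Y x ^ 2 : ℝ) : ℂ) * (u ^ 2 / 2) := fun x => by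
    push_cast
    ring
  have i1 : Integrable (fun x => (Y x : ℂ) * (u * Complex.I)) ν := hYi.ofReal.mul_const _
  have i2 : Integrable (fun x => ((Y x ^ 2 : ℝ) : ℂ) * (u ^ 2 / 2)) ν := hY2.ofReal.mul_const _
  have i3 : Integrable (fun x => 1 + (Y x : ℂ) * (u * Complex.I)
      - ((Y x ^ 2 : ℝ) : ℂ) * (u ^ 2 / 2)) ν := ((integrable_const 1).add i1).sub i2
  have hval : ∫ x, (1 + (Y x : ℂ) * (u * Complex.I)
      - ((Y x ^ 2 : ℝ) : ℂ) * (u ^ 2 / 2)) ∂ν = (1 : ℂ) - (u : ℂ) ^ 2 / 2 := by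
    have i4 : Integrable (fun x => (1 : ℂ) + (Y x : ℂ) * (u * Complex.I)) ν :=
      (integrable_const 1).add i1
    rw [integral_sub i4 i2, integral_add (integrable_const 1) i1, integral_mul_const,
      integral_mul_const, integral_complex_ofReal, integral_complex_ofReal, h₁, h₂]
    simp
  have hA : ‖(∫ x, Complex.exp ((u * Y x : ℝ) * Complex.I) ∂ν) - ((1 : ℂ) - (u : ℂ) ^ 2 / 2)‖ ≤
      |u| ^ 3 * K := by
    rw [← hval, ← integral_sub hexp i3]
    have hle : ∫ x, |u| ^ 3 * K * Y x ^ 2 ∂ν = |u| ^ 3 * K := by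
      rw [integral_const_mul, h₂, mul_one]
    rw [← hle]
    refine norm_integral_le_of_norm_le (hY2.const_mul _) ?_
    filter_upwards [hK] with x hx
    have h3 : |u * Y x| ≤ 1 := by
      rw [abs_mul]
      exact (mul_le_mul_of_nonneg_left hx (abs_nonneg u)).trans hu
    have h4 := norm_cexp_sub_taylor_two_le h3
    rw [hpoly] at h4
    refine h4.trans ?_
    rw [abs_mul, mul_pow, ← sq_abs (Y x)]
    calc |u| ^ 3 * |Y x| ^ 3 = |u| ^ 3 * (|Y x| * |Y x| ^ 2) := by ring
      _ ≤ |u| ^ 3 * (K * |Y x| ^ 2) := by gcongr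
      _ = _ := by ring
  have hB : ‖((1 : ℂ) - (u : ℂ) ^ 2 / 2) - Complex.exp (-(u ^ 2 / 2 : ℝ))‖ ≤ |u| ^ 3 * K := by
    have hsq : u ^ 2 ≤ 1 := by
      rw [← sq_abs]
      exact pow_le_one₀ (abs_nonneg _) hu1
    have h5 := Real.abs_exp_sub_one_sub_id_le (x := -(u ^ 2 / 2)) (by
      rw [abs_neg, abs_of_nonneg (by positivity)]
      linarith)
    have e : ((1 : ℂ) - (u : ℂ) ^ 2 / 2) - Complex.exp (-(u ^ 2 / 2 : ℝ)) =
        ((-(Real.exp (-(u ^ 2 / 2)) - 1 - -(u ^ 2 / 2)) : ℝ) : ℂ) := by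
      push_cast
      ring
    rw [e, Complex.norm_real, norm_neg, Real.norm_eq_abs]
    refine h5.trans ?_
    calc (-(u ^ 2 / 2)) ^ 2 = |u| ^ 3 * |u| / 4 := by
          rw [← pow_succ, (by decide : Even 4).pow_abs]
          ring
      _ ≤ |u| ^ 3 * K := by nlinarith [pow_nonneg (abs_nonneg u) 3, abs_nonneg u]
  calc _ ≤ ‖(∫ x, Complex.exp ((u * Y x : ℝ) * Complex.I) ∂ν) - ((1 : ℂ) - (u : ℂ) ^ 2 / 2)‖ +
        ‖((1 : ℂ) - (u : ℂ) ^ 2 / 2) - Complex.exp (-(u ^ 2 / 2 : ℝ))‖ :=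
          norm_sub_le_norm_sub_add_norm_sub ..
    _ ≤ _ := by linarith

/-- The characteristic function of the normalized sum of independent copies of a standardized
variable bounded by `K` is within `2 |t|³ K / √m` of the Gaussian one. -/
lemma norm_integral_cexp_sum_sub_le (hY : Measurable Y) (h₁ : ∫ x, Y x ∂ν = 0)
    (h₂ : ∫ x, Y x ^ 2 ∂ν = 1) (hK0 : 0 ≤ K) (hK : ∀ᵐ x ∂ν, |Y x| ≤ K) {m : ℕ} (hm : 0 < m)
    {η t : ℝ} (hη : K / √m ≤ η) (ht : |t| * η ≤ 1) :
    ‖(∫ x : Fin m → ℝ, Complex.exp ((t * ((∑ i, Y (x i)) / √m) : ℝ) * Complex.I)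
        ∂(Measure.pi fun _ => ν)) - Complex.exp (-(t ^ 2 / 2 : ℝ))‖ ≤ 2 * (|t| ^ 3 * η) := by
  have hm' : (0 : ℝ) < m := by exact_mod_cast hm
  have hsm : 0 < √(m : ℝ) := Real.sqrt_pos.2 hm'
  set u := t / √m with hu
  have hau : |u| = |t| / √m := by rw [hu, abs_div, abs_of_pos hsm]
  have huK : |u| * K ≤ 1 := by
    refine le_trans ?_ ht
    rw [hau, div_mul_eq_mul_div, mul_div_assoc]
    gcongr
  have hprod : ∫ x : Fin m → ℝ, Complex.exp ((t * ((∑ i, Y (x i)) / √m) : ℝ) * Complex.I)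
        ∂(Measure.pi fun _ => ν) =
      (∫ x, Complex.exp ((u * Y x : ℝ) * Complex.I) ∂ν) ^ m := by
    have := integral_fintype_prod_eq_pow (ι := Fin m)
      (fun x => Complex.exp ((u * Y x : ℝ) * Complex.I)) (μ := ν)
    rw [Fintype.card_fin] at this
    rw [← this]
    congr 1
    ext x
    rw [← Complex.exp_sum]
    congr 1
    rw [← Finset.sum_mul, ← Complex.ofReal_sum, ← Finset.mul_sum, hu]
    congr 2
    ring
  have hgauss : Complex.exp (-(t ^ 2 / 2 : ℝ)) = Complex.exp (-(u ^ 2 / 2 : ℝ)) ^ m := by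
    rw [← Complex.exp_nat_mul]
    congr 1
    rw [hu, div_pow, Real.sq_sqrt hm'.le]
    push_cast
    have : (m : ℂ) ≠ 0 := by exact_mod_cast hm.ne'
    field_simp
  rw [hprod, hgauss]
  have hn1 : ‖∫ x, Complex.exp ((u * Y x : ℝ) * Complex.I) ∂ν‖ ≤ 1 := by
    refine (norm_integral_le_of_norm_le_const (C := 1) (ae_of_all _ fun x => ?_)).trans ?_
    · rw [Complex.norm_exp_ofReal_mul_I]
    · simp
  have hn2 : ‖Complex.exp (-(u ^ 2 / 2 : ℝ))‖ ≤ 1 := by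
    rw [← Complex.ofReal_neg, ← Complex.ofReal_exp, Complex.norm_real,
      Real.norm_of_nonneg (Real.exp_nonneg _), Real.exp_le_one_iff]
    have := sq_nonneg u
    linarith
  refine (norm_pow_sub_pow_le_of_norm_le_one hn1 hn2 m).trans ?_
  have h := norm_integral_cexp_sub_le hY h₁ h₂ hK0 hK huK
  calc (m : ℝ) * _ ≤ m * (2 * (|u| ^ 3 * K)) := by gcongr
    _ = 2 * (|t| ^ 3 * (K / √m)) := by
        rw [hau, div_pow]
        have : (√(m : ℝ)) ^ 2 = m := Real.sq_sqrt hm'.le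
        field_simp
        rw [this]
        ring
    _ ≤ _ := by gcongr

end Standardized

/-! ### The estimator and its sample variance given the weighting -/

section Estimator

variable {ν : Measure ℝ} [IsProbabilityMeasure ν] {q : ℝ → ℝ}

lemma memLp_comp_eval (hq : MemLp q 2 ν) {m : ℕ} (i : Fin m) :
    MemLp (fun x : Fin m → ℝ => q (x i)) 2 (Measure.pi fun _ => ν) :=
  hq.comp_measurePreserving (measurePreserving_eval (fun _ : Fin m => ν) i)

lemma memLp_affineEstimator (hq : MemLp q 2 ν) (q₀ : ℝ) (m : ℕ) :
    MemLp (affineEstimator q₀ q) 2 (Measure.pi fun _ : Fin m => ν) := by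
  have h := (memLp_finsetSum Finset.univ fun i _ => memLp_comp_eval hq (m := m) i).const_mul
    ((m : ℝ)⁻¹)
  have h' := (memLp_const (μ := Measure.pi fun _ : Fin m => ν) (p := 2) q₀).add h
  refine h'.ae_eq (ae_of_all _ fun x => ?_)
  simp [affineEstimator, div_eq_inv_mul]

lemma integral_affineEstimator (hq : MemLp q 2 ν) (q₀ : ℝ) {m : ℕ} (hm : 0 < m) :
    ∫ x, affineEstimator q₀ q x ∂(Measure.pi fun _ : Fin m => ν) = q₀ + ∫ x, q x ∂ν := by
  have hi : ∀ i : Fin m, ∫ x : Fin m → ℝ, q (x i) ∂(Measure.pi fun _ => ν) = ∫ x, q x ∂ν :=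
    fun i => by
      have := integral_map (μ := Measure.pi fun _ : Fin m => ν) (f := q)
        (measurable_pi_apply i).aemeasurable (by
          rw [(measurePreserving_eval (fun _ : Fin m => ν) i).map_eq]
          exact hq.1)
      rw [(measurePreserving_eval (fun _ : Fin m => ν) i).map_eq] at this
      exact this.symm
  have hint := fun i : Fin m => (memLp_comp_eval hq i).integrable one_le_two
  have hm' : (m : ℝ) ≠ 0 := by exact_mod_cast hm.ne'
  unfold affineEstimator
  rw [integral_add (integrable_const _) ((integrable_finsetSum _ fun i _ => hint i).div_const _),
    integral_div, integral_finsetSum _ fun i _ => hint i]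
  simp only [hi]
  simp
  field_simp

lemma variance_affineEstimator (hq : MemLp q 2 ν) (q₀ : ℝ) {m : ℕ} (hm : 0 < m) :
    Var[affineEstimator q₀ q; Measure.pi fun _ : Fin m => ν] = Var[q; ν] / m := by
  have hm' : (m : ℝ) ≠ 0 := by exact_mod_cast hm.ne'
  have e : affineEstimator q₀ q = fun x : Fin m → ℝ =>
      q₀ + (m : ℝ)⁻¹ * (∑ i, fun ω : Fin m → ℝ => q (ω i)) x := by
    ext x
    simp [affineEstimator, div_eq_inv_mul]
  have hsum : MemLp (∑ i, fun ω : Fin m → ℝ => q (ω i)) 2 (Measure.pi fun _ : Fin m => ν) :=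
    memLp_finsetSum' _ fun i _ => memLp_comp_eval hq i
  rw [e, variance_const_add (hsum.const_mul _).1, variance_const_mul,
    variance_sum_pi (X := fun _ => q) fun _ => hq]
  simp
  field_simp

/-- Chebyshev's inequality for a mean of independent copies. -/
lemma measure_abs_mean_sub_ge_le (hq : MemLp q 2 ν) {m : ℕ} (hm : 0 < m) {a v : ℝ} (ha : 0 < a)
    (hv : Var[q; ν] ≤ v) :
    (Measure.pi fun _ : Fin m => ν) {x | a ≤ |(∑ i, q (x i)) / m - ∫ x, q x ∂ν|} ≤
      ENNReal.ofReal (v / m / a ^ 2) := by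
  have h := meas_ge_le_variance_div_sq (memLp_affineEstimator hq 0 m) ha
  rw [integral_affineEstimator hq 0 hm, variance_affineEstimator hq 0 hm] at h
  simp only [affineEstimator, zero_add] at h
  refine h.trans (ENNReal.ofReal_le_ofReal ?_)
  gcongr

lemma sampleVar_affine {m : ℕ} (hm : 0 < m) {Y : ℝ → ℝ} {σ μ : ℝ}
    (h : ∀ x, q x = σ * Y x + μ) (x : Fin m → ℝ) :
    sampleVar q x = σ ^ 2 * sampleVar Y x := by
  have hm' : (m : ℝ) ≠ 0 := by exact_mod_cast hm.ne'
  have h1 : ∑ i, q (x i) = σ * (∑ i, Y (x i)) + m * μ := by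
    simp [h, Finset.sum_add_distrib, Finset.mul_sum]
  have h2 : ∑ i, q (x i) ^ 2 =
      σ ^ 2 * (∑ i, Y (x i) ^ 2) + 2 * σ * μ * (∑ i, Y (x i)) + m * μ ^ 2 := by
    simp only [h, Finset.mul_sum]
    rw [← Finset.sum_add_distrib]
    have : (m : ℝ) * μ ^ 2 = ∑ _i : Fin m, μ ^ 2 := by simp
    rw [this, ← Finset.sum_add_distrib]
    refine Finset.sum_congr rfl fun i _ => ?_
    ring
  unfold sampleVar
  rw [h1, h2]
  field_simp
  ring

/-- The sample variance of standardized bounded variables concentrates, by Chebyshev's inequality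
for the means of `Y²` and of `Y`. -/
lemma measure_abs_sampleVar_sub_one_ge_le {Y : ℝ → ℝ} {K : ℝ} (hY : Measurable Y)
    (h₁ : ∫ x, Y x ∂ν = 0) (h₂ : ∫ x, Y x ^ 2 ∂ν = 1) (hK0 : 0 ≤ K)
    (hK : ∀ᵐ x ∂ν, |Y x| ≤ K) {m : ℕ} (hm : 2 ≤ m) {a e : ℝ} (ha : 0 < a) (ha1 : a ≤ 1)
    (hae : 4 * a + 1 / ((m : ℝ) - 1) ≤ e) :
    (Measure.pi fun _ : Fin m => ν) {x | e ≤ |m * sampleVar Y x - 1|} ≤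
      ENNReal.ofReal (2 * (K ^ 2 / m / a ^ 2)) := by
  have hK1 := one_le_of_integral_sq_eq_one h₂ hK0 hK
  have hm0 : 0 < m := by omega
  have hm2 : (2 : ℝ) ≤ m := by exact_mod_cast hm
  have hYp : MemLp Y 2 ν := MemLp.of_bound hY.aestronglyMeasurable K hK
  have hY2p : MemLp (fun x => Y x ^ 2) 2 ν := by
    refine MemLp.of_bound (hY.pow_const 2).aestronglyMeasurable (K ^ 2) ?_
    filter_upwards [hK] with x hx
    rw [norm_pow, Real.norm_eq_abs]
    gcongr
  have hv1 : Var[Y; ν] ≤ K ^ 2 := by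
    rw [variance_eq_sub hYp, h₁]
    simp only [Pi.pow_apply, h₂]
    nlinarith
  have hv2 : Var[fun x => Y x ^ 2; ν] ≤ K ^ 2 := by
    refine (variance_le_expectation_sq hY2p.1).trans ?_
    have : ∫ x, K ^ 2 * Y x ^ 2 ∂ν = K ^ 2 := by rw [integral_const_mul, h₂, mul_one]
    rw [← this]
    refine integral_mono_ae hY2p.integrable_sq (hYp.integrable_sq.const_mul _) ?_
    filter_upwards [hK] with x hx
    simp only [Pi.pow_apply]
    have h3 : Y x ^ 2 ≤ K ^ 2 := by
      rw [← sq_abs]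
      gcongr
    nlinarith [sq_nonneg (Y x)]
  have c1 := measure_abs_mean_sub_ge_le hYp hm0 ha hv1
  have c2 := measure_abs_mean_sub_ge_le hY2p hm0 ha hv2
  rw [h₁] at c1
  rw [h₂] at c2
  have hsub : {x : Fin m → ℝ | e ≤ |m * sampleVar Y x - 1|} ⊆
      {x | a ≤ |(∑ i, Y (x i)) / m - 0|} ∪ {x | a ≤ |(∑ i, Y (x i) ^ 2) / m - 1|} := by
    intro x hx
    by_contra hcon
    simp only [mem_union, mem_ofPred_eq, not_or, not_le, sub_zero] at hcon hx
    obtain ⟨hB, hA⟩ := hcon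
    set A := (∑ i, Y (x i) ^ 2) / (m : ℝ) with hAdef
    set B := (∑ i, Y (x i)) / (m : ℝ) with hBdef
    have hrepr : m * sampleVar Y x - 1 =
        (m / ((m : ℝ) - 1)) * (A - 1 - B ^ 2) + 1 / ((m : ℝ) - 1) := by
      have h3 : (m : ℝ) ≠ 0 := by positivity
      have h4 : (m : ℝ) - 1 ≠ 0 := by linarith
      unfold sampleVar
      rw [hAdef, hBdef]
      field_simp
      ring
    have hB2 : B ^ 2 < a := by
      rw [← sq_abs]
      nlinarith [abs_nonneg B]
    have hin : |A - 1 - B ^ 2| < 2 * a := by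
      rw [abs_lt] at *
      constructor <;> nlinarith [sq_nonneg B]
    have hratio : (m : ℝ) / ((m : ℝ) - 1) ≤ 2 := by
      rw [div_le_iff₀ (by linarith)]
      linarith
    have hratio0 : 0 < (m : ℝ) / ((m : ℝ) - 1) := div_pos (by linarith) (by linarith)
    have hm1 : 0 < 1 / ((m : ℝ) - 1) := one_div_pos.2 (by linarith)
    have : |m * sampleVar Y x - 1| < e := by
      rw [hrepr]
      refine (abs_add_le _ _).trans_lt ?_
      rw [abs_mul, abs_of_pos hratio0, abs_of_pos hm1]
      nlinarith [abs_nonneg (A - 1 - B ^ 2)]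
    linarith
  refine (measure_mono hsub).trans ((measure_union_le _ _).trans ((add_le_add c1 c2).trans ?_))
  rw [← ENNReal.ofReal_add (by positivity) (by positivity), two_mul]

end Estimator

section Bounded

variable {G : Measure ℝ} [IsProbabilityMeasure G] {q : ℝ → ℝ}

/-- Standardization of a bounded weighting with positive variance. -/
lemma exists_standardized {ν : Measure ℝ} [IsProbabilityMeasure ν] (hq : Measurable q) {b : ℝ}
    (hb : ∀ᵐ x ∂ν, |q x| ≤ b) (hσ : 0 < Var[q; ν]) :
    ∃ Y : ℝ → ℝ, Measurable Y ∧ (∀ x, q x = √Var[q; ν] * Y x + ∫ x, q x ∂ν) ∧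
      ∫ x, Y x ∂ν = 0 ∧ ∫ x, Y x ^ 2 ∂ν = 1 ∧ ∀ᵐ x ∂ν, |Y x| ≤ 2 * b / √Var[q; ν] := by
  have hs : 0 < √Var[q; ν] := Real.sqrt_pos.2 hσ
  have hqi : Integrable q ν := Integrable.of_bound hq.aestronglyMeasurable b hb
  refine ⟨fun x => (q x - ∫ y, q y ∂ν) / √Var[q; ν], by fun_prop, fun x => ?_, ?_, ?_, ?_⟩
  · field_simp
    ring
  · rw [integral_div, integral_sub hqi (integrable_const _)]
    simp
  · simp only [div_pow]
    rw [integral_div, Real.sq_sqrt hσ.le, ← variance_eq_integral hq.aemeasurable, div_self hσ.ne']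
  · have hm : |∫ y, q y ∂ν| ≤ b := by
      have := norm_integral_le_of_norm_le_const (μ := ν) (f := q) hb
      simpa using this
    filter_upwards [hb] with x hx
    rw [abs_div, abs_of_pos hs]
    gcongr
    refine (abs_sub _ _).trans ?_
    linarith

variable {m : ℕ} {b η : ℝ}

lemma condVariance_eq (hq : MemLp q 2 (marginalLaw G)) (q₀ : ℝ) (hm : 0 < m) :
    condVariance G m q₀ q = Var[q; marginalLaw G] / m := by
  have := isProbabilityMeasure_marginalLaw G
  exact variance_affineEstimator hq q₀ hm

lemma condBias_eq (hq : MemLp q 2 (marginalLaw G)) (ψ : ℝ → ℝ) (q₀ : ℝ) (hm : 0 < m) :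
    condBias ψ G m q₀ q = q₀ + (∫ x, q x ∂(marginalLaw G)) - linFun ψ G := by
  have := isProbabilityMeasure_marginalLaw G
  unfold condBias sampleLaw
  rw [integral_affineEstimator hq q₀ hm]

/-- The conditional characteristic function of the standardized estimator is close to that of the
standard normal distribution as soon as the weighting is small compared with the standard
deviation of the sum. -/
lemma norm_integral_cexp_estimator_sub_le (hq : Measurable q)
    (hb : ∀ᵐ x ∂(marginalLaw G), |q x| ≤ b) (hσ : 0 < Var[q; marginalLaw G]) (hm : 0 < m)
    (hη0 : 0 ≤ η) (hη : 4 * b ^ 2 ≤ η ^ 2 * (m * Var[q; marginalLaw G])) {t : ℝ} (ht : |t| * η ≤ 1)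
    (ψ : ℝ → ℝ) (q₀ : ℝ) :
    ‖(∫ x, Complex.exp ((t * ((affineEstimator q₀ q x - linFun ψ G - condBias ψ G m q₀ q)
        / √(condVariance G m q₀ q)) : ℝ) * Complex.I) ∂(sampleLaw G m))
      - Complex.exp (-(t ^ 2 / 2 : ℝ))‖ ≤ 2 * (|t| ^ 3 * η) := by
  have := isProbabilityMeasure_marginalLaw G
  have hqp : MemLp q 2 (marginalLaw G) := MemLp.of_bound hq.aestronglyMeasurable b hb
  have hb0 : 0 ≤ b := by
    obtain ⟨x, hx⟩ := hb.exists
    exact (abs_nonneg _).trans hx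
  have hm' : (0 : ℝ) < m := by exact_mod_cast hm
  have hs : 0 < √Var[q; marginalLaw G] := Real.sqrt_pos.2 hσ
  obtain ⟨Y, hYm, hqY, h₁, h₂, hK⟩ := exists_standardized hq hb hσ
  have hKη : 2 * b / √Var[q; marginalLaw G] / √m ≤ η := by
    rw [div_div, ← Real.sqrt_mul hσ.le, div_le_iff₀ (by positivity)]
    refine (sq_le_sq₀ (by positivity) (by positivity)).1 ?_
    rw [mul_pow, mul_pow, Real.sq_sqrt (by positivity)]
    linarith
  refine le_trans (le_of_eq ?_)
    (norm_integral_cexp_sum_sub_le hYm h₁ h₂ (by positivity) hK hm hKη ht)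
  unfold sampleLaw
  congr 3
  ext x
  congr 4
  rw [condBias_eq hqp ψ q₀ hm, condVariance_eq hqp q₀ hm, Real.sqrt_div hσ.le]
  have hsum : ∑ i, q (x i) =
      √Var[q; marginalLaw G] * (∑ i, Y (x i)) + m * ∫ x, q x ∂(marginalLaw G) := by
    simp only [fun i => hqY (x i), Finset.sum_add_distrib, Finset.mul_sum]
    simp
  unfold affineEstimator
  rw [hsum]
  have hsm : (√(m : ℝ)) ^ 2 = m := Real.sq_sqrt hm'.le
  have : 0 < √(m : ℝ) := Real.sqrt_pos.2 hm'
  field_simp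
  rw [hsm]
  ring

lemma sampleLaw_abs_sampleVar_div_sub_one_ge_le (hq : Measurable q)
    (hb : ∀ᵐ x ∂(marginalLaw G), |q x| ≤ b) (hσ : 0 < Var[q; marginalLaw G]) (hm : 2 ≤ m)
    (hη : 4 * b ^ 2 ≤ η ^ 2 * (m * Var[q; marginalLaw G])) {a e : ℝ} (ha : 0 < a) (ha1 : a ≤ 1)
    (hae : 4 * a + 1 / ((m : ℝ) - 1) ≤ e) (q₀ : ℝ) :
    sampleLaw G m {x | e ≤ |sampleVar q x / condVariance G m q₀ q - 1|} ≤
      ENNReal.ofReal (2 * (η ^ 2 / a ^ 2)) := by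
  have := isProbabilityMeasure_marginalLaw G
  have hqp : MemLp q 2 (marginalLaw G) := MemLp.of_bound hq.aestronglyMeasurable b hb
  have hb0 : 0 ≤ b := by
    obtain ⟨x, hx⟩ := hb.exists
    exact (abs_nonneg _).trans hx
  have hm0 : 0 < m := by omega
  have hm' : (0 : ℝ) < m := by exact_mod_cast hm0
  obtain ⟨Y, hYm, hqY, h₁, h₂, hK⟩ := exists_standardized hq hb hσ
  have heq : ∀ x : Fin m → ℝ, sampleVar q x / condVariance G m q₀ q = m * sampleVar Y x := by
    intro x
    rw [sampleVar_affine hm0 hqY, Real.sq_sqrt hσ.le, condVariance_eq hqp q₀ hm0]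
    field_simp
  simp only [heq]
  refine (measure_abs_sampleVar_sub_one_ge_le hYm h₁ h₂ (by positivity) hK hm ha ha1 hae).trans
    (ENNReal.ofReal_le_ofReal ?_)
  have : (2 * b / √Var[q; marginalLaw G]) ^ 2 / m ≤ η ^ 2 := by
    rw [div_pow, Real.sq_sqrt hσ.le, div_div, div_le_iff₀ (by positivity)]
    linarith
  gcongr

end Bounded

/-! ### Integration over the first fold -/

section HighProbability

variable {Ω : Type*} [MeasurableSpace Ω] {P : Measure Ω}

lemma WithHighProb.inter {A B : ℕ → Set Ω} (hA : WithHighProb P A) (hB : WithHighProb P B) :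
    WithHighProb P fun m => A m ∩ B m := by
  unfold WithHighProb at *
  have h := hA.add hB
  rw [add_zero] at h
  refine tendsto_of_tendsto_of_tendsto_of_le_of_le tendsto_const_nhds h (fun _ => zero_le)
    fun m => ?_
  simp only [compl_inter]
  exact measure_union_le _ _

lemma WithHighProb.mono {A B : ℕ → Set Ω} (hA : WithHighProb P A)
    (h : ∀ᶠ m in atTop, A m ⊆ B m) : WithHighProb P B :=
  tendsto_of_tendsto_of_tendsto_of_le_of_le' tendsto_const_nhds hA
    (Eventually.of_forall fun _ => zero_le)
    (h.mono fun _ hm => measure_mono (compl_subset_compl.2 hm))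

lemma withHighProb_abs_sub_le {f : ℕ → Ω → ℝ} {a : ℝ}
    (h : TendstoInMeasure P f atTop fun _ => a) {r : ℝ} (hr : 0 < r) :
    WithHighProb P fun m => {ω | |f m ω - a| ≤ r} := by
  rw [tendstoInMeasure_iff_norm] at h
  refine tendsto_of_tendsto_of_tendsto_of_le_of_le tendsto_const_nhds (h r hr) (fun _ => zero_le)
    fun m => measure_mono fun ω hω => ?_
  simp only [mem_compl_iff, mem_ofPred_eq, not_le, Real.norm_eq_abs] at hω ⊢
  exact hω.le

lemma tendstoInMeasure_of_withHighProb {f : ℕ → Ω → ℝ} {a : ℝ}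
    (h : ∀ r, 0 < r → WithHighProb P fun m => {ω | |f m ω - a| ≤ r}) :
    TendstoInMeasure P f atTop fun _ => a := by
  rw [tendstoInMeasure_iff_norm]
  intro r hr
  refine tendsto_of_tendsto_of_tendsto_of_le_of_le tendsto_const_nhds (h (r / 2) (half_pos hr))
    (fun _ => zero_le) fun m => measure_mono fun ω hω hω' => ?_
  simp only [mem_ofPred_eq, Real.norm_eq_abs] at hω hω'
  linarith

/-- Bounded convergence in probability for nonnegative functions, measurable or not. -/
lemma tendsto_lintegral_zero_of_withHighProb [IsProbabilityMeasure P] {g : ℕ → Ω → ℝ≥0∞}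
    {B : ℝ≥0∞} (hB : B ≠ ⊤) (hg : ∀ m ω, g m ω ≤ B)
    (h : ∀ r : ℝ, 0 < r → WithHighProb P fun m => {ω | g m ω ≤ ENNReal.ofReal r}) :
    Tendsto (fun m => ∫⁻ ω, g m ω ∂P) atTop (𝓝 0) := by
  have hle : ∀ (r : ℝ) m, ∫⁻ ω, g m ω ∂P ≤
      ENNReal.ofReal r + B * P {ω | g m ω ≤ ENNReal.ofReal r}ᶜ := by
    intro r m
    set A := toMeasurable P {ω | g m ω ≤ ENNReal.ofReal r}ᶜ with hA
    have hAm : MeasurableSet A := measurableSet_toMeasurable _ _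
    calc ∫⁻ ω, g m ω ∂P ≤ ∫⁻ ω, (ENNReal.ofReal r + A.indicator (fun _ => B) ω) ∂P := by
          refine lintegral_mono fun ω => ?_
          by_cases hω : g m ω ≤ ENNReal.ofReal r
          · exact hω.trans le_self_add
          · have : ω ∈ A := subset_toMeasurable _ _ hω
            rw [indicator_of_mem this]
            exact (hg m ω).trans le_add_self
      _ = ENNReal.ofReal r + B * P {ω | g m ω ≤ ENNReal.ofReal r}ᶜ := by
          rw [lintegral_add_left measurable_const, lintegral_indicator_const hAm, hA,
            measure_toMeasurable]
          simp
  rw [ENNReal.tendsto_nhds_zero]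
  intro e he
  obtain ⟨r, hr0, hr⟩ : ∃ r : ℝ, 0 < r ∧ ENNReal.ofReal r ≤ e / 2 := by
    rcases eq_or_ne e ⊤ with rfl | hne
    · exact ⟨1, one_pos, by simp [ENNReal.top_div]⟩
    · refine ⟨(e / 2).toReal, ENNReal.toReal_pos (ENNReal.half_pos he.ne').ne' ?_, ?_⟩
      · exact (ENNReal.half_lt_self he.ne' hne).ne_top
      · rw [ENNReal.ofReal_toReal (ENNReal.half_lt_self he.ne' hne).ne_top]
  have hlim : Tendsto (fun m => B * P {ω | g m ω ≤ ENNReal.ofReal r}ᶜ) atTop (𝓝 0) := by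
    have := ENNReal.Tendsto.const_mul (h r hr0) (Or.inr hB)
    rwa [mul_zero] at this
  filter_upwards [(ENNReal.tendsto_nhds_zero.1 hlim) (e / 2) (ENNReal.half_pos he.ne')] with m hm
  calc ∫⁻ ω, g m ω ∂P ≤ _ := hle r m
    _ ≤ e / 2 + e / 2 := add_le_add hr hm
    _ = e := ENNReal.add_halves e

/-- The joint law of the first fold and the first `m` observations of the second fold. -/
lemma map_folds_eq [IsProbabilityMeasure P] {G : Measure ℝ} {Xt X : ℕ → Ω → ℝ}
    (hXt : ∀ i, Measurable (Xt i)) (hX : ∀ i, Measurable (X i))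
    (h_indep : iIndepFun (Sum.elim Xt X) P) (hX_law : ∀ i, P.map (X i) = marginalLaw G) (m : ℕ) :
    P.map (fun ω => ((fun i => Xt i ω : ℕ → ℝ), (fun i : Fin m => X i ω))) =
      (P.map fun ω => (fun i => Xt i ω : ℕ → ℝ)).prod (sampleLaw G m) := by
  have hmeas : ∀ j, Measurable (Sum.elim Xt X j) := by
    rintro (i | i)
    · exact hXt i
    · exact hX i
  have hI := (iIndepFun_iff_iIndep _ _ _).1 h_indep
  have hdisj : Disjoint (range (Sum.inl : ℕ → ℕ ⊕ ℕ)) (range (Sum.inr : ℕ → ℕ ⊕ ℕ)) :=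
    isCompl_range_inl_range_inr.disjoint
  have hind := indep_iSup_of_disjoint (fun j => (hmeas j).comap_le) hI hdisj
  have h1 : IndepFun (fun ω => (fun i => Xt i ω : ℕ → ℝ))
      (fun ω => (fun i : Fin m => X i ω)) P := by
    rw [IndepFun_iff_Indep]
    refine indep_of_indep_of_le_left (indep_of_indep_of_le_right hind ?_) ?_
    · simp only [MeasurableSpace.pi, MeasurableSpace.comap_iSup, MeasurableSpace.comap_comp]
      exact iSup_le fun i => le_iSup₂_of_le (Sum.inr (i : ℕ)) (mem_range_self _) le_rfl
    · simp only [MeasurableSpace.pi, MeasurableSpace.comap_iSup, MeasurableSpace.comap_comp]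
      exact iSup_le fun i => le_iSup₂_of_le (Sum.inl i) (mem_range_self _) le_rfl
  have h2 : P.map (fun ω => (fun i : Fin m => X i ω)) = sampleLaw G m := by
    have hinj : Function.Injective fun i : Fin m => (Sum.inr (i : ℕ) : ℕ ⊕ ℕ) :=
      Sum.inr_injective.comp Fin.val_injective
    have h3 := (h_indep.precomp hinj).map_fun_eq_pi_map fun i => (hmeas _).aemeasurable
    simp only [Sum.elim_inr, hX_law] at h3
    exact h3
  have m1 : Measurable fun ω => (fun i => Xt i ω : ℕ → ℝ) := measurable_pi_lambda _ hXt
  have m2 : Measurable fun ω => (fun i : Fin m => X i ω) := measurable_pi_lambda _ fun i => hX i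
  rw [(indepFun_iff_map_prod_eq_prod_map_map m1.aemeasurable m2.aemeasurable).1 h1, h2]

end HighProbability

section Measurability

variable {S : Type*} [MeasurableSpace S] {G : Measure ℝ} [IsProbabilityMeasure G]
  {Q₀ : S → ℝ} {Q : S → ℝ → ℝ}

lemma measurable_sum_weighting (hQ : Measurable (Function.uncurry Q)) (m k : ℕ) :
    Measurable fun p : S × (Fin m → ℝ) => ∑ i, Q p.1 (p.2 i) ^ k :=
  Finset.measurable_fun_sum _ fun i _ => (hQ.comp
    (measurable_fst.prodMk ((measurable_pi_apply i).comp measurable_snd))).pow_const k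

lemma measurable_affineEstimator (hQ₀ : Measurable Q₀) (hQ : Measurable (Function.uncurry Q))
    (m : ℕ) : Measurable fun p : S × (Fin m → ℝ) => affineEstimator (Q₀ p.1) (Q p.1) p.2 := by
  have h := measurable_sum_weighting hQ m 1
  simp only [pow_one] at h
  exact (hQ₀.comp measurable_fst).add (h.div_const _)

lemma measurable_sampleVar (hQ : Measurable (Function.uncurry Q))
    (m : ℕ) : Measurable fun p : S × (Fin m → ℝ) => sampleVar (Q p.1) p.2 := by
  have h := measurable_sum_weighting hQ m 1
  simp only [pow_one] at h
  exact ((measurable_sum_weighting hQ m 2).sub ((h.pow_const 2).div_const _)).const_mul _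

lemma isProbabilityMeasure_sampleLaw (G : Measure ℝ) [IsProbabilityMeasure G] (m : ℕ) :
    IsProbabilityMeasure (sampleLaw G m) := by
  have := isProbabilityMeasure_marginalLaw G
  unfold sampleLaw
  infer_instance

lemma measurable_integral_affineEstimator (hQ₀ : Measurable Q₀)
    (hQ : Measurable (Function.uncurry Q)) (m : ℕ) :
    Measurable fun s => ∫ x, affineEstimator (Q₀ s) (Q s) x ∂(sampleLaw G m) := by
  have := isProbabilityMeasure_sampleLaw G m
  exact (measurable_affineEstimator hQ₀ hQ m).stronglyMeasurable.integral_prod_right'.measurable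

lemma measurable_condBias (hQ₀ : Measurable Q₀) (hQ : Measurable (Function.uncurry Q)) (ψ : ℝ → ℝ)
    (m : ℕ) : Measurable fun s => condBias ψ G m (Q₀ s) (Q s) :=
  (measurable_integral_affineEstimator hQ₀ hQ m).sub_const _

lemma measurable_condVariance (hQ₀ : Measurable Q₀) (hQ : Measurable (Function.uncurry Q))
    (m : ℕ) : Measurable fun s => condVariance G m (Q₀ s) (Q s) := by
  have := isProbabilityMeasure_sampleLaw G m
  have h : Measurable fun p : S × (Fin m → ℝ) => ‖affineEstimator (Q₀ p.1) (Q p.1) p.2 -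
      ∫ x, affineEstimator (Q₀ p.1) (Q p.1) x ∂(sampleLaw G m)‖ₑ ^ 2 :=
    ((measurable_affineEstimator hQ₀ hQ m).sub
      ((measurable_integral_affineEstimator hQ₀ hQ m).comp measurable_fst)).enorm.pow_const 2
  exact h.lintegral_prod_right'.ennreal_toReal

end Measurability

/-! ### Limit theorems -/

/-- The properties of a weighting on which the limit theorems rest: it is small compared with the
standard deviation of the sum, the variance proxy is nearly the variance, and the bias bound is
valid. A weighting bounded by `b` standardizes to one bounded by `2 b / σ`, and `exists_bound` says
that this bound is at most `η √m`. -/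
structure IsGoodWeighting (ψ : ℝ → ℝ) (G : Measure ℝ) (m : ℕ) (fbar : ℝ → ℝ)
    (𝒢m : Set (Measure ℝ)) (η q₀ : ℝ) (q : ℝ → ℝ) : Prop where
  variance_pos : 0 < Var[q; marginalLaw G]
  exists_bound : ∃ b, (∀ᵐ x ∂(marginalLaw G), |q x| ≤ b) ∧
    4 * b ^ 2 ≤ η ^ 2 * (m * Var[q; marginalLaw G])
  abs_proxy_sub_one_le : |(∫ x, q x ^ 2 * fbar x) / (m * condVariance G m q₀ q) - 1| ≤ η
  abs_condBias_le : |condBias ψ G m q₀ q| ≤ biasBound ψ 𝒢m q₀ q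

lemma WeightingEstimates.abs_variance_sub_le {ν : Measure ℝ} [IsProbabilityMeasure ν]
    {fbar : ℝ → ℝ} {δ ε s : ℝ} {q : ℝ → ℝ} (h : WeightingEstimates ν fbar δ ε s q)
    (hq : Measurable q) (hε : ε ≤ 1 / 2) : |Var[q; ν] - s ^ 2| ≤ 3 * ε * s ^ 2 := by
  have hqp : MemLp q 2 ν := MemLp.of_bound hq.aestronglyMeasurable _ h.bound
  have h1 : (∫ x, q x ∂ν) ^ 2 ≤ 2 * ε * s ^ 2 := by
    have h2 : (∫ x, q x ∂ν) ^ 2 ≤ (2 * ε * s) ^ 2 := by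
      rw [← sq_abs]
      exact pow_le_pow_left₀ (abs_nonneg _) h.first_moment 2
    have h3 : 0 ≤ ε * s ^ 2 := mul_nonneg h.eps_nonneg (sq_nonneg _)
    nlinarith
  have h4 := abs_le.1 h.second_moment
  rw [variance_eq_sub hqp]
  simp only [Pi.pow_apply]
  rw [abs_le]
  constructor <;> nlinarith [sq_nonneg (∫ x, q x ∂ν)]

/-- In terms of the localization radius `c`, the standardized weighting is of order `c / (κ δ)`, so
the limit theorems need `c² / (m δ²)` to be small. -/
lemma WeightingEstimates.isGoodWeighting {ψ : ℝ → ℝ} {G : Measure ℝ} [IsProbabilityMeasure G]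
    {fbar : ℝ → ℝ} {𝒢m : Set (Measure ℝ)} {δ κ c s η q₀ : ℝ} {q : ℝ → ℝ} {m : ℕ}
    (h : WeightingEstimates (marginalLaw G) fbar δ (2 * c / κ) s q)
    (hbias : |q₀ + (∫ x, q x ∂(marginalLaw G)) - linFun ψ G| ≤ biasBound ψ 𝒢m q₀ q)
    (hq : Measurable q) (hm : 0 < m) (hδ : 0 < δ) (hκ : 0 < κ) (hc1 : 2 * c / κ ≤ 1 / 6)
    (hc2 : 2 * c / κ ≤ η / 6) (hrate : c ^ 2 / (m * δ ^ 2) ≤ η ^ 2 * κ ^ 2 / 128) :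
    IsGoodWeighting ψ G m fbar 𝒢m η q₀ q := by
  have := isProbabilityMeasure_marginalLaw G
  have hm' : (0 : ℝ) < m := by exact_mod_cast hm
  have hqp : MemLp q 2 (marginalLaw G) := MemLp.of_bound hq.aestronglyMeasurable _ h.bound
  have hs := h.pos
  have hs2 : 0 < s ^ 2 := by positivity
  have hvar := h.abs_variance_sub_le hq (by linarith)
  have hv2 : s ^ 2 / 2 ≤ Var[q; marginalLaw G] := by
    have := (abs_le.1 hvar).1
    nlinarith
  have hvpos : 0 < Var[q; marginalLaw G] := by linarith
  refine ⟨hvpos, ⟨_, h.bound, ?_⟩, ?_, ?_⟩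
  · rw [div_le_iff₀ (by positivity)] at hrate
    have e : 4 * (2 * (2 * c / κ) * s / δ) ^ 2 = 64 * s ^ 2 * c ^ 2 / (κ ^ 2 * δ ^ 2) := by
      field_simp
      ring
    rw [e, div_le_iff₀ (by positivity)]
    have h1 : 64 * s ^ 2 * c ^ 2 ≤ 64 * s ^ 2 * (η ^ 2 * κ ^ 2 / 128 * (m * δ ^ 2)) := by gcongr
    have h2 : η ^ 2 * (m * (s ^ 2 / 2)) * (κ ^ 2 * δ ^ 2) ≤
        η ^ 2 * (m * Var[q; marginalLaw G]) * (κ ^ 2 * δ ^ 2) := by gcongr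
    linarith
  · rw [condVariance_eq hqp q₀ hm, h.integral_sq, mul_div_cancel₀ _ hm'.ne',
      div_sub_one hvpos.ne', abs_div, abs_of_pos hvpos, div_le_iff₀ hvpos, abs_sub_comm]
    refine hvar.trans ?_
    have h3 : 3 * (2 * c / κ) * s ^ 2 ≤ 3 * (η / 6) * s ^ 2 := by gcongr
    have hη : 0 ≤ η := by linarith [h.eps_nonneg]
    nlinarith
  · rwa [condBias_eq hqp ψ q₀ hm]

section Limits

variable {Ω : Type*} [MeasurableSpace Ω] {P : Measure Ω} [IsProbabilityMeasure P]
  {G : Measure ℝ} [IsProbabilityMeasure G] {Xt X : ℕ → Ω → ℝ}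
  {Q₀ : ℕ → (ℕ → ℝ) → ℝ} {Q : ℕ → (ℕ → ℝ) → ℝ → ℝ}
  {ψ : ℝ → ℝ} {fbar : ℕ → (ℕ → ℝ) → ℝ → ℝ} {𝒢m : ℕ → (ℕ → ℝ) → Set (Measure ℝ)}

/-- Asymptotic normality of the standardized estimator. By Fubini its characteristic function is
the mean of the conditional one over the first fold, which converges in probability and is
bounded; Lévy's continuity theorem concludes. -/
lemma tendstoInDistribution_standardized_estimator
    (hXt : ∀ i, Measurable (Xt i)) (hX : ∀ i, Measurable (X i))
    (hjoint : ∀ m : ℕ, P.map (fun ω => ((fun i => Xt i ω : ℕ → ℝ), (fun i : Fin m => X i ω))) =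
      (P.map fun ω => (fun i => Xt i ω : ℕ → ℝ)).prod (sampleLaw G m))
    (hQ₀_meas : ∀ m, Measurable (Q₀ m)) (hQ_meas : ∀ m, Measurable (Function.uncurry (Q m)))
    (hgood : ∀ η, 0 < η → WithHighProb P fun m => {ω | IsGoodWeighting ψ G m
      (fbar m fun i => Xt i ω) (𝒢m m fun i => Xt i ω) η (Q₀ m fun i => Xt i ω)
      (Q m fun i => Xt i ω)}) :
    TendstoInDistribution
      (fun (m : ℕ) ω =>
        (affineEstimator (Q₀ m fun i => Xt i ω) (Q m fun i => Xt i ω) (fun i : Fin m => X i ω)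
            - linFun ψ G - condBias ψ G m (Q₀ m fun i => Xt i ω) (Q m fun i => Xt i ω))
          / √(condVariance G m (Q₀ m fun i => Xt i ω) (Q m fun i => Xt i ω)))
      atTop (id : ℝ → ℝ) (fun _ => P) (gaussianReal 0 1) := by
  have m1 : Measurable fun ω => (fun i => Xt i ω : ℕ → ℝ) := measurable_pi_lambda _ hXt
  have m2 : ∀ m : ℕ, Measurable fun ω => (fun i : Fin m => X i ω) :=
    fun m => measurable_pi_lambda _ fun i => hX i
  set T : (m : ℕ) → (ℕ → ℝ) × (Fin m → ℝ) → ℝ := fun m p =>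
    (affineEstimator (Q₀ m p.1) (Q m p.1) p.2 - linFun ψ G - condBias ψ G m (Q₀ m p.1) (Q m p.1))
      / √(condVariance G m (Q₀ m p.1) (Q m p.1)) with hT
  have hTm : ∀ m, Measurable (T m) := fun m =>
    (((measurable_affineEstimator (hQ₀_meas m) (hQ_meas m) m).sub_const _).sub
      ((measurable_condBias (hQ₀_meas m) (hQ_meas m) ψ m).comp measurable_fst)).div
      ((measurable_condVariance (hQ₀_meas m) (hQ_meas m) m).comp measurable_fst).sqrt
  have hZm : ∀ m : ℕ, Measurable fun ω =>
      T m ((fun i => Xt i ω : ℕ → ℝ), (fun i : Fin m => X i ω)) :=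
    fun m => (hTm m).comp (m1.prodMk (m2 m))
  refine ⟨fun m => (hZm m).aemeasurable, aemeasurable_id, ?_⟩
  refine ProbabilityMeasure.tendsto_iff_tendsto_charFun.2 fun t => ?_
  have hprob1 := Measure.isProbabilityMeasure_map (μ := P) m1.aemeasurable
  set Φ : ℕ → (ℕ → ℝ) → ℂ := fun m s =>
    ∫ x, Complex.exp ((t * T m (s, x) : ℝ) * Complex.I) ∂(sampleLaw G m) with hΦ
  have hexpm : ∀ m, Measurable fun p => Complex.exp ((t * T m p : ℝ) * Complex.I) := fun m => by
    have := hTm m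
    fun_prop
  have hexpi : ∀ m, Integrable (fun p => Complex.exp ((t * T m p : ℝ) * Complex.I))
      ((P.map fun ω => (fun i => Xt i ω : ℕ → ℝ)).prod (sampleLaw G m)) := fun m => by
    have := isProbabilityMeasure_sampleLaw G m
    refine Integrable.of_bound (C := 1) (hexpm m).aestronglyMeasurable (ae_of_all _ fun x => ?_)
    rw [Complex.norm_exp_ofReal_mul_I]
  have hΦm : ∀ m, StronglyMeasurable (Φ m) := fun m => by
    have := isProbabilityMeasure_sampleLaw G m
    exact (hexpm m).stronglyMeasurable.integral_prod_right'
  have hΦ1 : ∀ m s, ‖Φ m s‖ ≤ 1 := fun m s => by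
    have := isProbabilityMeasure_sampleLaw G m
    refine (norm_integral_le_of_norm_le_const (C := 1) (ae_of_all _ fun x => ?_)).trans ?_
    · rw [Complex.norm_exp_ofReal_mul_I]
    · simp
  have hchar : ∀ m : ℕ, charFun (P.map fun ω =>
      T m ((fun i => Xt i ω : ℕ → ℝ), (fun i : Fin m => X i ω))) t =
      ∫ ω, Φ m (fun i => Xt i ω) ∂P := fun m => by
    have := isProbabilityMeasure_sampleLaw G m
    rw [charFun_apply_real, integral_map (hZm m).aemeasurable (by fun_prop)]
    have h1 := integral_map (μ := P) (m1.prodMk (m2 m)).aemeasurable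
      (hexpm m).aestronglyMeasurable
    have h2 := integral_map (μ := P) m1.aemeasurable (hΦm m).aestronglyMeasurable
    rw [← h2, hΦ, ← integral_prod _ (hexpi m), ← hjoint m, h1]
    simp
  set g : ℂ := Complex.exp (-(t ^ 2 / 2 : ℝ)) with hg
  have hg1 : ‖g‖ ≤ 1 := by
    rw [hg, ← Complex.ofReal_neg, ← Complex.ofReal_exp, Complex.norm_real,
      Real.norm_of_nonneg (Real.exp_nonneg _), Real.exp_le_one_iff]
    have := sq_nonneg t
    linarith
  have hlim : Tendsto (fun m => ∫⁻ ω, ‖Φ m (fun i => Xt i ω) - g‖ₑ ∂P) atTop (𝓝 0) := by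
    refine tendsto_lintegral_zero_of_withHighProb (B := ENNReal.ofReal 2) ENNReal.ofReal_ne_top
      (fun m ω => ?_) fun r hr => ?_
    · rw [← ofReal_norm]
      refine ENNReal.ofReal_le_ofReal ((norm_sub_le _ _).trans ?_)
      linarith [hΦ1 m fun i => Xt i ω]
    -- The first bound on `η` makes the Taylor expansion applicable, the second one makes its error
    -- at most `r`.
    · set η : ℝ := min (1 / (|t| + 1)) (r / (2 * (|t| ^ 3 + 1))) with hη
      have hη0 : 0 < η := by positivity
      have hη1 : |t| * η ≤ 1 := by
        have h1 : |t| * η ≤ |t| * (1 / (|t| + 1)) := by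
          gcongr
          exact min_le_left _ _
        refine h1.trans ?_
        rw [mul_one_div, div_le_one (by positivity)]
        linarith
      have hη2 : 2 * (|t| ^ 3 * η) ≤ r := by
        have h1 : 2 * (|t| ^ 3 * η) ≤ 2 * (|t| ^ 3 * (r / (2 * (|t| ^ 3 + 1)))) := by
          gcongr
          exact min_le_right _ _
        refine h1.trans ?_
        have : 2 * (|t| ^ 3 * (r / (2 * (|t| ^ 3 + 1)))) = r * (|t| ^ 3 / (|t| ^ 3 + 1)) := by
          field_simp
        rw [this]
        refine mul_le_of_le_one_right hr.le ?_
        rw [div_le_one (by positivity)]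
        linarith
      refine (hgood η hη0).mono ?_
      filter_upwards [eventually_gt_atTop 0] with m hm ω hω
      simp only [mem_ofPred_eq] at hω ⊢
      obtain ⟨b, hb, hb2⟩ := hω.exists_bound
      rw [← ofReal_norm]
      refine ENNReal.ofReal_le_ofReal (le_trans ?_ hη2)
      have hqm : Measurable (Q m fun i => Xt i ω) := (hQ_meas m).of_uncurry_left
      have key := norm_integral_cexp_estimator_sub_le hqm hb hω.variance_pos hm hη0.le hb2 hη1 ψ
        (Q₀ m fun i => Xt i ω)
      exact key
  have hnorm : Tendsto (fun m => ∫ ω, Φ m (fun i => Xt i ω) ∂P) atTop (𝓝 g) := by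
    rw [tendsto_iff_edist_tendsto_0]
    refine tendsto_of_tendsto_of_tendsto_of_le_of_le tendsto_const_nhds hlim (fun _ => zero_le)
      fun m => ?_
    have hi : Integrable (fun ω => Φ m (fun i => Xt i ω)) P :=
      Integrable.of_bound ((hΦm m).comp_measurable m1).aestronglyMeasurable 1
        (ae_of_all _ fun ω => hΦ1 m _)
    have : (∫ ω, Φ m (fun i => Xt i ω) ∂P) - g = ∫ ω, (Φ m (fun i => Xt i ω) - g) ∂P := by
      rw [integral_sub hi (integrable_const _)]
      simp
    rw [edist_eq_enorm_sub, this]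
    exact enorm_integral_le_lintegral_enorm _
  have hgauss : charFun ((gaussianReal 0 1).map id) t = g := by
    rw [Measure.map_id, charFun_gaussianReal, hg]
    congr 1
    push_cast
    ring
  simp only [ProbabilityMeasure.coe_mk]
  rw [hgauss]
  refine hnorm.congr fun m => ?_
  rw [← hchar m]

/-- Consistency of the sample variance: the conditional probability of a deviation tends to zero
in probability. -/
lemma tendstoInMeasure_sampleVar_div_condVariance
    (hXt : ∀ i, Measurable (Xt i)) (hX : ∀ i, Measurable (X i))
    (hjoint : ∀ m : ℕ, P.map (fun ω => ((fun i => Xt i ω : ℕ → ℝ), (fun i : Fin m => X i ω))) =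
      (P.map fun ω => (fun i => Xt i ω : ℕ → ℝ)).prod (sampleLaw G m))
    (hQ₀_meas : ∀ m, Measurable (Q₀ m)) (hQ_meas : ∀ m, Measurable (Function.uncurry (Q m)))
    (hgood : ∀ η, 0 < η → WithHighProb P fun m => {ω | IsGoodWeighting ψ G m
      (fbar m fun i => Xt i ω) (𝒢m m fun i => Xt i ω) η (Q₀ m fun i => Xt i ω)
      (Q m fun i => Xt i ω)}) :
    TendstoInMeasure P
      (fun (m : ℕ) ω => sampleVar (Q m fun i => Xt i ω) (fun i : Fin m => X i ω)
        / condVariance G m (Q₀ m fun i => Xt i ω) (Q m fun i => Xt i ω))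
      atTop (fun _ => (1 : ℝ)) := by
  have m1 : Measurable fun ω => (fun i => Xt i ω : ℕ → ℝ) := measurable_pi_lambda _ hXt
  have m2 : ∀ m : ℕ, Measurable fun ω => (fun i : Fin m => X i ω) :=
    fun m => measurable_pi_lambda _ fun i => hX i
  rw [tendstoInMeasure_iff_norm]
  intro e he
  set R : (m : ℕ) → (ℕ → ℝ) × (Fin m → ℝ) → ℝ := fun m p =>
    sampleVar (Q m p.1) p.2 / condVariance G m (Q₀ m p.1) (Q m p.1) with hR
  have hRm : ∀ m, Measurable (R m) := fun m => (measurable_sampleVar (hQ_meas m) m).div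
    ((measurable_condVariance (hQ₀_meas m) (hQ_meas m) m).comp measurable_fst)
  have hset : ∀ m, MeasurableSet {p | e ≤ |R m p - 1|} := fun m =>
    measurableSet_le measurable_const ((hRm m).sub_const 1).abs
  have heq : ∀ m : ℕ, P {ω | e ≤ ‖sampleVar (Q m fun i => Xt i ω) (fun i : Fin m => X i ω)
        / condVariance G m (Q₀ m fun i => Xt i ω) (Q m fun i => Xt i ω) - 1‖} =
      ∫⁻ ω, sampleLaw G m {x | e ≤ |R m ((fun i => Xt i ω), x) - 1|} ∂P := fun m => by
    have := isProbabilityMeasure_sampleLaw G m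
    have h1 := Measure.map_apply (μ := P) (m1.prodMk (m2 m)) (hset m)
    rw [hjoint m, Measure.prod_apply (hset m),
      lintegral_map (measurable_measure_prodMk_left (hset m)) m1] at h1
    exact h1.symm
  simp only [heq]
  refine tendsto_lintegral_zero_of_withHighProb (B := 1) ENNReal.one_ne_top
    (fun m ω => ?_) fun r hr => ?_
  · have := isProbabilityMeasure_sampleLaw G m
    exact prob_le_one
  · set a : ℝ := min (e / 8) 1 with ha
    have ha0 : 0 < a := by positivity
    set η : ℝ := a * √(r / 2) with hη
    have hη0 : 0 < η := by positivity
    have hη2 : 2 * (η ^ 2 / a ^ 2) = r := by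
      rw [hη, mul_pow, Real.sq_sqrt (by positivity)]
      field_simp
    refine (hgood η hη0).mono ?_
    filter_upwards [eventually_ge_atTop 2, eventually_ge_atTop (⌈2 / e⌉₊ + 1)] with m hm hm' ω hω
    simp only [mem_ofPred_eq] at hω ⊢
    obtain ⟨b, hb, hb2⟩ := hω.exists_bound
    have hm1 : 2 / e ≤ (m : ℝ) - 1 := by
      have h1 : ((⌈2 / e⌉₊ : ℝ)) + 1 ≤ m := by exact_mod_cast hm'
      linarith [Nat.le_ceil (2 / e)]
    have hm2 : 1 / ((m : ℝ) - 1) ≤ e / 2 := by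
      have : 0 < 2 / e := by positivity
      rw [div_le_iff₀ (by linarith)]
      calc (1 : ℝ) = e / 2 * (2 / e) := by field_simp
        _ ≤ _ := by gcongr
    have hqm : Measurable (Q m fun i => Xt i ω) := (hQ_meas m).of_uncurry_left
    rw [← hη2]
    have hae : 4 * a + 1 / ((m : ℝ) - 1) ≤ e := by
      have := min_le_left (e / 8) 1
      linarith
    have key := sampleLaw_abs_sampleVar_div_sub_one_ge_le hqm hb hω.variance_pos hm hb2 ha0
      (min_le_right _ _) hae (Q₀ m fun i => Xt i ω)
    exact key

end Limits

end MinimaxAffine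

theorem mainTheorem1
    {Ω : Type*} [MeasurableSpace Ω] (P : Measure Ω) [IsProbabilityMeasure P]
    -- the convex class, the true effect size distribution, the functional
    (𝒢 : Set (Measure ℝ)) (h𝒢_prob : ∀ H ∈ 𝒢, IsProbabilityMeasure H) (h𝒢_conv : Convex ℝ≥0 𝒢)
    (G : Measure ℝ) (hG : G ∈ 𝒢)
    (ψ : ℝ → ℝ) (hψ_int : ∀ H ∈ 𝒢, Integrable ψ H) (hψ_bdd : ∃ C : ℝ, ∀ H ∈ 𝒢, |linFun ψ H| ≤ C)
    (M : ℝ) (hM : 0 < M)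
    -- the two folds: all observations are independent with density `f_G`
    (Xt X : ℕ → Ω → ℝ) (hXt : ∀ i, Measurable (Xt i)) (hX : ∀ i, Measurable (X i))
    (h_indep : iIndepFun (Sum.elim Xt X) P)
    (hXt_law : ∀ i, P.map (Xt i) = marginalLaw G) (hX_law : ∀ i, P.map (X i) = marginalLaw G)
    -- the pilot and the tuning parameters, all computed from the first fold
    (fbar : ℕ → (ℕ → ℝ) → ℝ → ℝ) (c δ dω : ℕ → (ℕ → ℝ) → ℝ)
    (hfbar_meas : ∀ m, Measurable (Function.uncurry (fbar m)))
    (hfbar_left : ∀ m xt, IntegrableOn (fbar m xt) (Iic (-M)))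
    (hfbar_right : ∀ m xt, IntegrableOn (fbar m xt) (Ici M))
    (hc_meas : ∀ m, Measurable (c m)) (hδ_meas : ∀ m, Measurable (δ m))
    (hdω_meas : ∀ m, Measurable (dω m))
    (hδ_pos : ∀ m xt, 0 < δ m xt)
    -- the localization band and the rates
    (h_band : WithHighProb P fun m => {ω | normInfM M
      (fun x => marginalDensity G x - fbar m (fun i => Xt i ω) x) ≤
        (c m (fun i => Xt i ω) : EReal)})
    (hc : TendstoInMeasure P (fun m ω => c m (fun i => Xt i ω)) atTop (fun _ => (0 : ℝ)))
    (hδ : TendstoInMeasure P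
      (fun (m : ℕ) ω => c m (fun i => Xt i ω) ^ 2 / ((m : ℝ) * δ m (fun i => Xt i ω) ^ 2))
      atTop (fun _ => (0 : ℝ)))
    -- `dω m` is a positive element of the superdifferential of the modulus at `δ m`
    (hdω : WithHighProb P fun m => {ω |
      let xt : ℕ → ℝ := fun i => Xt i ω
      IsSupergradient (modulus ψ M (fbar m xt) (localClass 𝒢 M (fbar m xt) (c m xt)))
        (δ m xt) (dω m xt)})
    (hdω_pos : WithHighProb P fun m => {ω | 0 < dω m (fun i => Xt i ω)})
    -- the modulus problem at `δ m` is attained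
    (h_attained : WithHighProb P fun m => {ω |
      let xt : ℕ → ℝ := fun i => Xt i ω
      ModulusAttained ψ M (fbar m xt) (localClass 𝒢 M (fbar m xt) (c m xt)) (δ m xt)})
    -- `(Q₀, Q)` solves the minimax problem with `Γ_m = m⁻¹ ω_m'(δ_m)²` if a solution exists
    (Q₀ : ℕ → (ℕ → ℝ) → ℝ) (Q : ℕ → (ℕ → ℝ) → ℝ → ℝ)
    (hQ₀_meas : ∀ m, Measurable (Q₀ m)) (hQ_meas : ∀ m, Measurable (Function.uncurry (Q m)))
    (hQ : WithHighProb P fun m => {ω |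
      let xt : ℕ → ℝ := fun i => Xt i ω
      let 𝒢m : Set (Measure ℝ) := localClass 𝒢 M (fbar m xt) (c m xt)
      (∃ q₀ q, IsMinimaxSolution ψ M m (fbar m xt) 𝒢m (dω m xt ^ 2 / m) q₀ q) →
        IsMinimaxSolution ψ M m (fbar m xt) 𝒢m (dω m xt ^ 2 / m) (Q₀ m xt) (Q m xt)}) :
    -- asymptotic normality
    TendstoInDistribution
      (fun (m : ℕ) ω =>
        let xt : ℕ → ℝ := fun i => Xt i ω
        (affineEstimator (Q₀ m xt) (Q m xt) (fun i : Fin m => X i ω) - linFun ψ G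
            - condBias ψ G m (Q₀ m xt) (Q m xt))
          / √(condVariance G m (Q₀ m xt) (Q m xt)))
      atTop (id : ℝ → ℝ) (fun _ => P) (gaussianReal 0 1) ∧
    -- consistency of the sample variance
    TendstoInMeasure P
      (fun (m : ℕ) ω =>
        let xt : ℕ → ℝ := fun i => Xt i ω
        sampleVar (Q m xt) (fun i : Fin m => X i ω) / condVariance G m (Q₀ m xt) (Q m xt))
      atTop (fun _ => (1 : ℝ)) ∧
    -- consistency of the variance proxy
    TendstoInMeasure P
      (fun (m : ℕ) ω =>
        let xt : ℕ → ℝ := fun i => Xt i ω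
        (∫ x, Q m xt x ^ 2 * fbar m xt x)
          / ((m : ℝ) * condVariance G m (Q₀ m xt) (Q m xt)))
      atTop (fun _ => (1 : ℝ)) ∧
    -- validity of the bias bound
    WithHighProb P (fun m => {ω |
      let xt : ℕ → ℝ := fun i => Xt i ω
      |condBias ψ G m (Q₀ m xt) (Q m xt)| ≤
        biasBound ψ (localClass 𝒢 M (fbar m xt) (c m xt)) (Q₀ m xt) (Q m xt)}) := by
  have hGp := h𝒢_prob G hG
  obtain ⟨C, hC⟩ := hψ_bdd
  obtain ⟨κ, hκ⟩ := exists_isCellLowerBound G M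
  have hκ0 := hκ.pos
  let 𝒢m : ℕ → (ℕ → ℝ) → Set (Measure ℝ) := fun m xt => localClass 𝒢 M (fbar m xt) (c m xt)
  have hgood : ∀ η, 0 < η → WithHighProb P fun m => {ω | IsGoodWeighting ψ G m
      (fbar m fun i => Xt i ω) (𝒢m m fun i => Xt i ω) η
      (Q₀ m fun i => Xt i ω) (Q m fun i => Xt i ω)} := by
    intro η hη
    -- The relative error `2 c / κ` of the pilot on the cells is then at most `1 / 6` and `η / 6`.
    have w1 := withHighProb_abs_sub_le hc (r := min (κ / 12) (η * κ / 12)) (by positivity)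
    have w2 := withHighProb_abs_sub_le hδ (r := η ^ 2 * κ ^ 2 / 128) (by positivity)
    refine (((((h_band.inter w1).inter w2).inter (hdω.inter hdω_pos)).inter h_attained).inter
      hQ).mono ?_
    filter_upwards [eventually_gt_atTop 0] with m hm ω hω
    obtain ⟨⟨⟨⟨⟨hb, h1⟩, h2⟩, h3, h4⟩, h5⟩, h6⟩ := hω
    simp only [mem_ofPred_eq, sub_zero] at hb h1 h2 h3 h4 h5 h6 ⊢
    have hc1 := (le_abs_self _).trans (h1.trans (min_le_left _ _))
    have hc2 := (le_abs_self _).trans (h1.trans (min_le_right _ _))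
    have hqm : Measurable (Q m fun i => Xt i ω) := (hQ_meas m).of_uncurry_left
    have hfm : Measurable (fbar m fun i => Xt i ω) := (hfbar_meas m).of_uncurry_left
    obtain ⟨hex, hall⟩ := minimaxSolution_estimates hM h𝒢_prob h𝒢_conv hG hψ_int hC hκ
      hfm (hfbar_left m _) (hfbar_right m _) hb (by linarith) hm
      (hδ_pos m _) h4 h3 h5
    obtain ⟨hW, hB⟩ := hall _ _ (h6 hex)
    refine hW.isGoodWeighting hB hqm hm (hδ_pos m _) hκ0 ?_ ?_
      ((le_abs_self _).trans h2)
    · rw [div_le_iff₀ hκ0]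
      linarith
    · rw [div_le_iff₀ hκ0]
      linarith
  have hjoint := map_folds_eq hXt hX h_indep hX_law
  have l1 := tendstoInDistribution_standardized_estimator (Q₀ := Q₀) (Q := Q) (fbar := fbar)
    (𝒢m := 𝒢m) hXt hX hjoint hQ₀_meas hQ_meas hgood
  have l2 := tendstoInMeasure_sampleVar_div_condVariance (Q₀ := Q₀) (Q := Q) (fbar := fbar)
    (𝒢m := 𝒢m) hXt hX hjoint hQ₀_meas hQ_meas hgood
  refine ⟨l1, l2, tendstoInMeasure_of_withHighProb fun r hr => ?_, ?_⟩
  · exact (hgood r hr).mono (Eventually.of_forall fun m ω hω => hω.abs_proxy_sub_one_le)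
  · exact (hgood 1 one_pos).mono (Eventually.of_forall fun m ω hω => hω.abs_condBias_le)
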